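/- There is an absolute constant $K>0$ such that the following holds. Let $R$ be a commutative ring, let $n\ge 2$, $d\ge 1$ and $s\ge n$ be integers, and let $f\in R[x_1,\dots,x_n]$ be a polynomial of total degree at most $d$ computed by an arithmetic circuit over $R$ of size $s$. (An arithmetic circuit is a finite acyclic directed graph, with parallel arrows allowed, whose vertices of in-degree $0$ are labelled by variables or elements of $R$ and whose other vertices are $+$-gates or $\times$-gates of arbitrary fan-in; its size is its number of vertices.) Put $$\alpha=\sqrt{d\,\frac{\log n}{\log (ds)}},\qquad \beta=\sqrt{d\,\frac{\log (ds)}{\log n}} .$$ Then $f$ is computed by a $\Sigma\Pi^{[\max(1,K\alpha)]}\Sigma\Pi^{[\beta]}$ circuit over $R$ of size at most $2^{K\sqrt{d\log(ds)\log n}}$, and if $f$ is homogeneous this depth-4 circuit can moreover be taken homogeneous. Here a $\Sigma\Pi^{[a]}\Sigma\Pi^{[b]}$ circuit is a circuit layered in levels $0,\dots,4$, every arrow going from one level to the next, with inputs at level $0$, $\times$-gates of fan-in at most $b$ at level $1$, $+$-gates at level $2$, $\times$-gates of fan-in at most $a$ at level $3$, and $+$-gates (among them the output) at level $4$; constant inputs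 count towards the fan-in. The degree of a gate is $-\infty$ for the constant $0$, $0$ for other constants, $1$ for a variable, the maximum of the degrees of its inputs for a $+$-gate and their sum for a $\times$-gate; a circuit is homogeneous if for every $+$-gate all its inputs have the same degree. -/

import Mathlib

universe u

/-- The label of a vertex `g` of an arithmetic circuit over `R` in the variables `x_0, …, x_{n-1}`,
together with the origins of the arrows that enter `g`. The origins form a multiset, so parallel
arrows are allowed, and the fan-in is the cardinality of that multiset. -/
inductive Gate (R : Type u) (n : ℕ) (V : Type) : Type u
  | const (c : R) : Gate R n V
  | var (i : Fin n) : Gate R n V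
  | add (m : Multiset V) : Gate R n V
  | mul (m : Multiset V) : Gate R n V

namespace Gate

variable {R : Type u} {n : ℕ} {V : Type}

/-- The origins of the incoming arrows of a gate. -/
def inputs : Gate R n V → Multiset V
  | const _ => 0
  | var _ => 0
  | add m => m
  | mul m => m

/-- `+`- and `×`-gates. -/
def IsComputation : Gate R n V → Prop
  | const _ => False
  | var _ => False
  | add _ => True
  | mul _ => True

end Gate

/-- An arithmetic circuit over `R` in `n` variables: a finite acyclic directed graph on the vertex
set `V` whose vertices of in-degree `0` are labelled by constants or variables and whose other
vertices are labelled by `+` or `×`, of any fan-in, with a designated output vertex. For a finite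
graph, well-foundedness of the arrow relation is the same as acyclicity. Gates from which the output
cannot be reached are allowed and counted in the size; removing them changes nothing but the size,
which decreases. -/
structure Circuit (R : Type u) (n : ℕ) where
  V : Type
  [fintypeV : Fintype V]
  gate : V → Gate R n V
  inputs_ne_zero : ∀ g, (gate g).IsComputation → (gate g).inputs ≠ 0
  acyclic : WellFounded fun h g : V => h ∈ (gate g).inputs
  output : V

attribute [instance] Circuit.fintypeV

namespace Circuit

variable {R : Type u} {n : ℕ}

/-- The size of a circuit: its number of gates. -/
def size (C : Circuit R n) : ℕ := Fintype.card C.V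

/-- Recursion along the arrows of a circuit. -/
noncomputable def fold {X : Type*} (C : Circuit R n) (const : R → X) (var : Fin n → X)
    (add mul : Multiset X → X) : C.V → X :=
  C.acyclic.fix fun g rec =>
    match hg : C.gate g with
    | .const c => const c
    | .var i => var i
    | .add m => add (m.attach.map fun h => rec h.1 (by rw [hg]; exact h.2))
    | .mul m => mul (m.attach.map fun h => rec h.1 (by rw [hg]; exact h.2))

/-- The defining equation of `Circuit.fold`. -/
theorem fold_eq {X : Type*} (C : Circuit R n) (const : R → X) (var : Fin n → X)
    (add mul : Multiset X → X) (g : C.V) :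
    C.fold const var add mul g =
      match C.gate g with
      | .const c => const c
      | .var i => var i
      | .add m => add (m.map (C.fold const var add mul))
      | .mul m => mul (m.map (C.fold const var add mul)) := by
  have key : ∀ m : Multiset C.V,
      (m.attach.map fun h => C.fold const var add mul h.1) =
        m.map (C.fold const var add mul) := by
    intro m
    exact Multiset.attach_map_val' m (C.fold const var add mul)
  conv_lhs => unfold fold
  rw [WellFounded.fix_eq]
  change (match hg : C.gate g with
    | .const c => const c
    | .var i => var i
    | .add m => add (m.attach.map fun h : {x // x ∈ m} => C.fold const var add mul h.1)
    | .mul m => mul (m.attach.map fun h : {x // x ∈ m} => C.fold const var add mul h.1)) = _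
  split <;> rename_i heq <;> simp only [heq, key]

/-- The polynomial computed by a gate. -/
noncomputable def eval [CommRing R] (C : Circuit R n) : C.V → MvPolynomial (Fin n) R :=
  C.fold MvPolynomial.C MvPolynomial.X Multiset.sum Multiset.prod

/-- The circuit `C` computes the polynomial `f`. -/
def Computes [CommRing R] (C : Circuit R n) (f : MvPolynomial (Fin n) R) : Prop :=
  C.eval C.output = f

open Classical in
/-- The (formal) degree of a gate: `-∞` for the constant `0`, `0` for other constants, `1` for a
variable, the maximum of the incoming degrees for a `+`-gate and their sum for a `×`-gate. -/
noncomputable def degree [CommRing R] (C : Circuit R n) : C.V → WithBot ℕ :=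
  C.fold (fun c => if c = 0 then ⊥ else 0) (fun _ => 1) Multiset.sup Multiset.sum

/-- A circuit is homogeneous if all the inputs of each `+`-gate have the same degree. -/
def IsHomogeneous [CommRing R] (C : Circuit R n) : Prop :=
  ∀ (g : C.V) (m : Multiset C.V), C.gate g = .add m →
    ∀ h ∈ m, ∀ h' ∈ m, C.degree h = C.degree h'

/-- What the gate `g` has to satisfy in a layered `ΣΠ^{[a]}ΣΠ^{[b]}` circuit with levels `lvl`:
inputs are at level `0`, `×`-gates at level `1` (fan-in at most `b`) or `3` (fan-in at most `a`),
`+`-gates at level `2` or `4`, and all arrows go from one level to the next. -/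
def LayeredAt (C : Circuit R n) (lvl : C.V → ℕ) (a b : ℝ) (g : C.V) : Prop :=
  match C.gate g with
  | .const _ => lvl g = 0
  | .var _ => lvl g = 0
  | .add m => (lvl g = 2 ∨ lvl g = 4) ∧ ∀ h ∈ m, lvl h + 1 = lvl g
  | .mul m => ((lvl g = 1 ∧ (m.card : ℝ) ≤ b) ∨ (lvl g = 3 ∧ (m.card : ℝ) ≤ a)) ∧
      ∀ h ∈ m, lvl h + 1 = lvl g

/-- `C` is a `ΣΠ^{[a]}ΣΠ^{[b]}` circuit: a depth-4 circuit with `×`-gates at levels `1` and `3`,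
of fan-in at most `b` and `a` respectively, and `+`-gates at levels `2` and `4`. Constant inputs
of a `×`-gate count towards its fan-in. -/
def IsSigmaPiSigmaPi (C : Circuit R n) (a b : ℝ) : Prop :=
  ∃ lvl : C.V → ℕ, lvl C.output = 4 ∧ ∀ g, C.LayeredAt lvl a b g

end Circuit

/-! The circuit is first replaced by a finite system of homogeneous polynomials in which every
member of degree at least two is a combination of products of two members. The system consists of
the components of degrees `1` to `d` of the gates, of powers of gates freed of their constant term,
and of partial products of the inputs of each gate. The powers are needed because parallel arrows
can raise an input to an arbitrarily large exponent; only exponents up to `d` matter in degrees up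
to `d`. The system has at most `(d * s) ^ 5` members (`systemSize_le`), and no division is used, so
any commutative ring will do.

In such a system, follow from each member the heavier factor. Cutting all these heavy paths where
the degree drops to a given bound (`eq_sum_frontier`) writes a member, or a quotient (the sum of the
path weights between two members), as a sum of products of three polynomials of the same kinds.
Cutting halfway and repeating until every factor has degree at most `t` takes at most `8 * D / t`
expansions for degree `D` (`isSumProd_val_and_quot`). Each expansion adds two factors and multiplies
the number of summands by the cube of the size of the system.

Finally, each factor is written out in its at most `n ^ t` monomials, which gives the depth-4
circuit. With `t` of order `β`, the number of expansions is of order `α`, and the size is `(d * s) ^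
O(α) * n ^ O(β)`. The two exponents balance: `α log (ds) = β log n = sqrt (d log (ds) log n)`.
Degrees add up to the same total in every product, so homogeneity is preserved. -/

open MvPolynomial

/-! ### Sums of products of homogeneous polynomials of small degree -/

/-- `g` is a sum of at most `N` products of at most `k` homogeneous polynomials of degree at most
`t`, the degrees in each product adding up to `D`. -/
def IsSumProd {R : Type u} [CommRing R] {σ : Type} (t N k D : ℕ) (g : MvPolynomial σ R) : Prop :=
  ∃ L : List (List (ℕ × MvPolynomial σ R)), L.length ≤ N ∧
    (∀ l ∈ L, l ≠ [] ∧ l.length ≤ k ∧ (l.map Prod.fst).sum = D ∧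
      ∀ q ∈ l, q.2.IsHomogeneous q.1 ∧ q.1 ≤ t) ∧
    (L.map fun l => (l.map Prod.snd).prod).sum = g

namespace IsSumProd

variable {R : Type u} [CommRing R] {σ : Type} {t : ℕ}

theorem mono {N N' k k' D : ℕ} {g : MvPolynomial σ R} (h : IsSumProd t N k D g) (hN : N ≤ N')
    (hk : k ≤ k') : IsSumProd t N' k' D g := by
  obtain ⟨L, h1, h2, h3⟩ := h
  exact ⟨L, h1.trans hN, fun l hl => ⟨(h2 l hl).1, (h2 l hl).2.1.trans hk, (h2 l hl).2.2⟩, h3⟩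

theorem zero (N k D : ℕ) : IsSumProd t N k D (0 : MvPolynomial σ R) :=
  ⟨[], by simp, by simp, by simp⟩

theorem of_isHomogeneous {D : ℕ} {g : MvPolynomial σ R} (h : g.IsHomogeneous D) (hD : D ≤ t) :
    IsSumProd t 1 1 D g :=
  ⟨[[(D, g)]], by simp, by simp [h, hD], by simp⟩

theorem add {N N' k D : ℕ} {g g' : MvPolynomial σ R} (h : IsSumProd t N k D g)
    (h' : IsSumProd t N' k D g') : IsSumProd t (N + N') k D (g + g') := by
  obtain ⟨L, h1, h2, h3⟩ := h
  obtain ⟨L', h1', h2', h3'⟩ := h'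
  refine ⟨L ++ L', by simp; omega, fun l hl => ?_, by simp [h3, h3']⟩
  rcases List.mem_append.1 hl with hl | hl
  exacts [h2 l hl, h2' l hl]

theorem sum {ι : Type*} (s : Finset ι) {N k D : ℕ} {g : ι → MvPolynomial σ R}
    (h : ∀ i ∈ s, IsSumProd t N k D (g i)) : IsSumProd t (s.card * N) k D (∑ i ∈ s, g i) := by
  classical
  induction s using Finset.induction_on with
  | empty => simpa using zero _ _ _
  | insert a s ha ih =>
    rw [Finset.sum_insert ha, Finset.card_insert_of_notMem ha]
    exact ((h a (by simp)).add (ih fun i hi => h i (by simp [hi]))).mono (le_of_eq (by ring)) le_rfl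

theorem smul {N k D : ℕ} {g : MvPolynomial σ R} (c : R) (h : IsSumProd t N k D g) :
    IsSumProd t N k D (c • g) := by
  obtain ⟨L, h1, h2, rfl⟩ := h
  -- The scalar is absorbed by the first factor, which exists because the products are nonempty; the
  -- number of factors and the degrees do not change.
  let F : List (ℕ × MvPolynomial σ R) → List (ℕ × MvPolynomial σ R) := fun l =>
    l.modifyHead fun q => (q.1, c • q.2)
  refine ⟨L.map F, by simpa using h1, ?_, ?_⟩
  · intro l' hl'
    obtain ⟨l, hl, rfl⟩ := List.mem_map.1 hl'
    obtain ⟨h4, h5, h6, h7⟩ := h2 l hl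
    cases l with
    | nil => exact absurd rfl h4
    | cons q l =>
      refine ⟨by simp [F], by simpa [F] using h5, by simpa [F] using h6, ?_⟩
      intro q' hq'
      simp only [F, List.modifyHead_cons, List.mem_cons] at hq'
      rcases hq' with rfl | hq'
      · obtain ⟨h8, h9⟩ := h7 q (by simp)
        refine ⟨?_, h9⟩
        rw [MvPolynomial.smul_eq_C_mul]
        simpa using (isHomogeneous_C σ c).mul h8
      · exact h7 q' (by simp [hq'])
  · rw [List.map_map, List.smul_sum, List.map_map]
    refine congrArg List.sum ?_
    refine List.map_congr_left fun l hl => ?_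
    obtain ⟨h4, -⟩ := h2 l hl
    cases l with
    | nil => exact absurd rfl h4
    | cons q l => simp [F]

theorem mul {N N' k k' D D' : ℕ} {g g' : MvPolynomial σ R} (h : IsSumProd t N k D g)
    (h' : IsSumProd t N' k' D' g') : IsSumProd t (N * N') (k + k') (D + D') (g * g') := by
  obtain ⟨L, h1, h2, rfl⟩ := h
  obtain ⟨L', h1', h2', rfl⟩ := h'
  refine ⟨(L ×ˢ L').map fun p => p.1 ++ p.2, ?_, ?_, ?_⟩
  · rw [List.length_map, List.length_product]
    exact Nat.mul_le_mul h1 h1'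
  · intro l hl
    obtain ⟨⟨a, b⟩, hab, rfl⟩ := List.mem_map.1 hl
    obtain ⟨ha, hb⟩ := List.mem_product.1 hab
    obtain ⟨a1, a2, a3, a4⟩ := h2 a ha
    obtain ⟨b1, b2, b3, b4⟩ := h2' b hb
    refine ⟨by simp [a1], by simp; omega, by simp [a3, b3], fun q hq => ?_⟩
    rcases List.mem_append.1 hq with hq | hq
    exacts [a4 q hq, b4 q hq]
  · rw [List.map_map]
    clear h1 h1' h2 h2'
    induction L with
    | nil => simp
    | cons a L ih =>
      rw [List.product_cons, List.map_append, List.sum_append, ih, List.map_cons, List.sum_cons,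
        add_mul, List.map_map]
      congr 1
      rw [← List.sum_map_mul_left]
      exact congrArg List.sum (List.map_congr_left fun b _ => by simp)

end IsSumProd

/-! ### Quadratic systems, heavy paths and gate quotients -/

/-- A finite system of homogeneous polynomials of positive degrees in which those of degree at least
`2` are combinations of products of two others, the first factor being at least as heavy as the
second. -/
structure QuadraticSystem (R : Type u) [CommRing R] (σ : Type) (U : Type) [Fintype U] where
  deg : U → ℕ
  val : U → MvPolynomial σ R
  coef : U → U → U → R
  deg_pos : ∀ u, 1 ≤ deg u
  homogeneous : ∀ u, (val u).IsHomogeneous (deg u)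
  coef_ne_zero : ∀ u a b, coef u a b ≠ 0 → deg a + deg b = deg u ∧ deg b ≤ deg a
  val_eq : ∀ u, 2 ≤ deg u → val u = ∑ a, ∑ b, coef u a b • (val b * val a)

namespace QuadraticSystem

variable {R : Type u} [CommRing R] {σ : Type} {U : Type} [Fintype U] (S : QuadraticSystem R σ U)

/-- The coefficient of `val a` in `val u`, seen as a linear form in the heavy factors. -/
noncomputable def weight (u a : U) : MvPolynomial σ R := ∑ b, S.coef u a b • S.val b

theorem weight_eq_zero {u a : U} (h : S.deg u ≤ S.deg a) : S.weight u a = 0 := by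
  refine Finset.sum_eq_zero fun b _ => ?_
  by_contra hne
  have h1 : S.coef u a b ≠ 0 := fun h0 => hne (by rw [h0, zero_smul])
  have := S.coef_ne_zero u a b h1
  have := S.deg_pos b
  omega

theorem weight_isHomogeneous (u a : U) :
    (S.weight u a).IsHomogeneous (S.deg u - S.deg a) := by
  refine IsHomogeneous.sum _ _ _ fun b _ => ?_
  by_cases h : S.coef u a b = 0
  · rw [h, zero_smul]; exact isHomogeneous_zero _ _ _
  · have h1 := (S.coef_ne_zero u a b h).1
    rw [show S.deg u - S.deg a = 0 + S.deg b by omega, MvPolynomial.smul_eq_C_mul]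
    exact (isHomogeneous_C σ _).mul (S.homogeneous b)

theorem val_eq_sum_weight {u : U} (h : 2 ≤ S.deg u) :
    S.val u = ∑ a, S.weight u a * S.val a := by
  rw [S.val_eq u h]
  refine Finset.sum_congr rfl fun a _ => ?_
  simp [weight, Finset.sum_mul]

open Classical in
/-- The gate quotient: the sum over all heavy paths from `u` to `v` of the product of the weights
along the path. -/
noncomputable def quot (u v : U) : MvPolynomial σ R :=
  if u = v then 1 else
    ∑ a, if _h : S.deg a < S.deg u then S.weight u a * quot a v else 0
termination_by S.deg u

theorem quot_self (u : U) : S.quot u u = 1 := by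
  rw [quot]; simp

theorem quot_of_ne {u v : U} (h : u ≠ v) : S.quot u v = ∑ a, S.weight u a * S.quot a v := by
  rw [quot, if_neg h]
  refine Finset.sum_congr rfl fun a _ => ?_
  split_ifs with h1
  · rfl
  · rw [S.weight_eq_zero (not_lt.1 h1), zero_mul]

/-- The degree strictly decreases along a heavy path, so no path leads to a different member of at
least the same degree. -/
theorem quot_eq_zero {u v : U} (h : S.deg u ≤ S.deg v) (hne : u ≠ v) : S.quot u v = 0 := by
  induction hn : S.deg u using Nat.strong_induction_on generalizing u with
  | _ n ih =>
    rw [S.quot_of_ne hne]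
    refine Finset.sum_eq_zero fun a _ => ?_
    by_cases h1 : S.deg a < S.deg u
    · rw [ih (S.deg a) (hn ▸ h1) (by omega) (by rintro rfl; omega) rfl, mul_zero]
    · rw [S.weight_eq_zero (not_lt.1 h1), zero_mul]

theorem quot_isHomogeneous (u v : U) : (S.quot u v).IsHomogeneous (S.deg u - S.deg v) := by
  induction hn : S.deg u using Nat.strong_induction_on generalizing u with
  | _ n ih =>
    subst hn
    by_cases hne : u = v
    · subst hne
      rw [quot_self, Nat.sub_self]
      exact isHomogeneous_one _ _
    rw [S.quot_of_ne hne]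
    refine IsHomogeneous.sum _ _ _ fun a _ => ?_
    by_cases h1 : S.deg a < S.deg u
    · by_cases h2 : S.deg v ≤ S.deg a
      · rw [show S.deg u - S.deg v = (S.deg u - S.deg a) + (S.deg a - S.deg v) by omega]
        exact (S.weight_isHomogeneous u a).mul (ih _ h1 a rfl)
      · rw [S.quot_eq_zero (u := a) (v := v) (by omega) (by rintro rfl; omega), mul_zero]
        exact isHomogeneous_zero _ _ _
    · rw [S.weight_eq_zero (not_lt.1 h1), zero_mul]
      exact isHomogeneous_zero _ _ _

/-- Cutting every heavy path from `u` at the place where the degree drops to at most `m`. -/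
theorem eq_sum_frontier (m : ℕ) (φ : U → MvPolynomial σ R)
    (hφ : ∀ u, m < S.deg u → φ u = ∑ a, S.weight u a * φ a) {u : U} (hu : m < S.deg u) :
    φ u = ∑ x with m < S.deg x, ∑ a with S.deg a ≤ m, S.quot u x * (S.weight x a * φ a) := by
  classical
  induction hn : S.deg u using Nat.strong_induction_on generalizing u with
  | _ n ih =>
    subst hn
    simp only [← Finset.mul_sum]
    set B : U → MvPolynomial σ R := fun x => ∑ a with S.deg a ≤ m, S.weight x a * φ a with hB
    have h1 : φ u = B u + ∑ a with ¬ S.deg a ≤ m, S.weight u a * φ a := by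
      rw [hφ u hu, hB]
      exact (Finset.sum_filter_add_sum_filter_not _ _ _).symm
    have h2 : ∀ a, ¬ S.deg a ≤ m → S.weight u a * φ a =
        ∑ x with m < S.deg x, S.weight u a * (S.quot a x * B x) := by
      intro a ha
      by_cases h3 : S.deg a < S.deg u
      · rw [ih _ h3 (not_le.1 ha) rfl, Finset.mul_sum]
        simp only [← Finset.mul_sum, hB]
      · simp [S.weight_eq_zero (not_lt.1 h3)]
    -- The recursion for the quotient may be restricted to intermediate members above the cut: `x`
    -- itself lies above it, and no path climbs back.
    have h4 : ∀ x, m < S.deg x → S.quot u x = (if u = x then 1 else 0) +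
        ∑ a with ¬ S.deg a ≤ m, S.weight u a * S.quot a x := by
      intro x hx
      have h5 : ∑ a with S.deg a ≤ m, S.weight u a * S.quot a x = 0 :=
        Finset.sum_eq_zero fun a ha => by
          have := (Finset.mem_filter.1 ha).2
          rw [S.quot_eq_zero (by omega) (by rintro rfl; omega), mul_zero]
      have h6 : ∑ a with ¬ S.deg a ≤ m, S.weight u a * S.quot a x =
          ∑ a, S.weight u a * S.quot a x := by
        rw [← Finset.sum_filter_add_sum_filter_not Finset.univ (fun a => S.deg a ≤ m), h5, zero_add]
      rw [h6]
      split_ifs with h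
      · subst h
        rw [quot_self, Finset.sum_eq_zero, add_zero]
        intro a _
        by_cases h3 : S.deg a < S.deg u
        · rw [S.quot_eq_zero h3.le (by rintro rfl; omega), mul_zero]
        · simp [S.weight_eq_zero (not_lt.1 h3)]
      · rw [S.quot_of_ne h, zero_add]
    rw [h1, Finset.sum_congr rfl fun a ha => h2 a (Finset.mem_filter.1 ha).2, Finset.sum_comm]
    have h7 : ∑ x with m < S.deg x, S.quot u x * B x = ∑ x with m < S.deg x,
        ((if u = x then B x else 0) +
          ∑ a with ¬ S.deg a ≤ m, S.weight u a * (S.quot a x * B x)) := by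
      refine Finset.sum_congr rfl fun x hx => ?_
      rw [h4 x (Finset.mem_filter.1 hx).2, add_mul, Finset.sum_mul]
      simp [mul_assoc]
    rw [h7, Finset.sum_add_distrib]
    congr 1
    rw [Finset.sum_ite_eq]
    simp [hu]

/-- Unfolding the weight at the cut yields triple products. The function `φ` is kept abstract so
that the same expansion serves for `S.val` and for `S.quot · v`. -/
theorem eq_sum_frontier_products (m : ℕ) (φ : U → MvPolynomial σ R)
    (hφ : ∀ u, m < S.deg u → φ u = ∑ a, S.weight u a * φ a) {u : U} (hu : m < S.deg u) :
    φ u = ∑ x, ∑ a, ∑ b, if m < S.deg x ∧ S.deg a ≤ m then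
      S.coef x a b • (S.quot u x * S.val b * φ a) else 0 := by
  rw [S.eq_sum_frontier m φ hφ hu, Finset.sum_filter]
  refine Finset.sum_congr rfl fun x _ => ?_
  rw [Finset.sum_filter]
  split_ifs with hx
  · refine Finset.sum_congr rfl fun a _ => ?_
    by_cases ha : S.deg a ≤ m
    · simp [hx, ha, weight, Finset.sum_mul, Finset.mul_sum, mul_assoc]
    · simp [ha]
  · simp [hx]

/-- A term-by-term bound for the expansion of `eq_sum_frontier_products`. -/
theorem isSumProd_of_frontier {t e D m : ℕ} (φ : U → MvPolynomial σ R)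
    (hφ : ∀ u, m < S.deg u → φ u = ∑ a, S.weight u a * φ a) {u : U} (hu : m < S.deg u)
    (h : ∀ x a b, m < S.deg x → S.deg a ≤ m → S.deg a + S.deg b = S.deg x →
      S.deg b ≤ S.deg a → S.quot u x ≠ 0 → φ a ≠ 0 → ∃ e₁ e₂ e₃ D₁ D₂ D₃,
        IsSumProd t ((Fintype.card U ^ 3) ^ e₁) (1 + 2 * e₁) D₁ (S.quot u x) ∧
        IsSumProd t ((Fintype.card U ^ 3) ^ e₂) (1 + 2 * e₂) D₂ (S.val b) ∧
        IsSumProd t ((Fintype.card U ^ 3) ^ e₃) (1 + 2 * e₃) D₃ (φ a) ∧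
        e₁ + e₂ + e₃ + 1 ≤ e ∧ D₁ + D₂ + D₃ = D) :
    IsSumProd t ((Fintype.card U ^ 3) ^ e) (1 + 2 * e) D (φ u) := by
  have hU : 1 ≤ Fintype.card U := Fintype.card_pos_iff.2 ⟨u⟩
  have hM : 1 ≤ Fintype.card U ^ 3 := Nat.one_le_pow _ _ hU
  rw [S.eq_sum_frontier_products m φ hφ hu]
  -- With no expansion allowed, the bound `e₁ + e₂ + e₃ + 1 ≤ e` is impossible, so every term of the
  -- sum must vanish.
  by_cases he : e = 0
  · rw [Finset.sum_eq_zero]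
    · exact IsSumProd.zero _ _ _
    refine fun x _ => Finset.sum_eq_zero fun a _ => Finset.sum_eq_zero fun b _ => ?_
    split_ifs with hxa
    · by_cases hc : S.coef x a b = 0
      · simp [hc]
      by_cases hq : S.quot u x = 0
      · simp [hq]
      by_cases ha : φ a = 0
      · simp [ha]
      obtain ⟨h1, h2⟩ := S.coef_ne_zero x a b hc
      obtain ⟨e₁, e₂, e₃, D₁, D₂, D₃, -, -, -, h3, -⟩ := h x a b hxa.1 hxa.2 h1 h2 hq ha
      omega
    · rfl
  have key : ∀ x a b, IsSumProd t ((Fintype.card U ^ 3) ^ (e - 1)) (1 + 2 * e) D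
      (if m < S.deg x ∧ S.deg a ≤ m then S.coef x a b • (S.quot u x * S.val b * φ a) else 0) := by
    intro x a b
    split_ifs with hxa
    · by_cases hc : S.coef x a b = 0
      · simpa [hc] using IsSumProd.zero _ _ _
      by_cases hq : S.quot u x = 0
      · simpa [hq] using IsSumProd.zero _ _ _
      by_cases ha : φ a = 0
      · simpa [ha] using IsSumProd.zero _ _ _
      obtain ⟨h1, h2⟩ := S.coef_ne_zero x a b hc
      obtain ⟨e₁, e₂, e₃, D₁, D₂, D₃, r₁, r₂, r₃, h3, rfl⟩ := h x a b hxa.1 hxa.2 h1 h2 hq ha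
      refine (((r₁.mul r₂).mul r₃).smul _).mono ?_ (by omega)
      rw [← pow_add, ← pow_add]
      exact Nat.pow_le_pow_right hM (by omega)
    · exact IsSumProd.zero _ _ _
  refine (IsSumProd.sum _ fun x _ => IsSumProd.sum _ fun a _ => IsSumProd.sum _ fun b _ =>
    key x a b).mono (le_of_eq ?_) le_rfl
  obtain ⟨e, rfl⟩ := Nat.exists_eq_succ_of_ne_zero he
  simp only [Finset.card_univ, Nat.succ_sub_one, pow_succ]
  ring

/-- Subtraction is truncated, so small pieces do not repay their allowance. Here `a` exceeds `t / 4`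
and one of `x`, `b` is at least `t / 4`; such pieces save their full allowances of `2` for a value
and `1` for a quotient. The worst case, with `b` negligible, saves `3`, which pays for this
expansion and leaves exactly `2`. -/
theorem expansions_val_le {t D x a b : ℕ} (ht : 1 ≤ t) (hD : t < D) (h : x + b + a = D)
    (ha : 2 * a ≤ D) (hb : b ≤ a) (hab : D < 2 * (a + b)) :
    (8 * x / t - 1) + (8 * b / t - 2) + (8 * a / t - 2) + 1 ≤ 8 * D / t - 2 := by
  have h1 : 8 * x / t + 8 * b / t + 8 * a / t ≤ 8 * D / t := by
    rw [Nat.le_div_iff_mul_le (by omega), add_mul, add_mul]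
    have := Nat.div_mul_le_self (8 * x) t
    have := Nat.div_mul_le_self (8 * a) t
    have := Nat.div_mul_le_self (8 * b) t
    omega
  have hq : ∀ y, t ≤ 4 * y → 2 ≤ 8 * y / t := fun y hy => by
    rw [Nat.le_div_iff_mul_le (by omega)]; omega
  have h2 := hq a (by omega)
  have h3 := hq x
  have h4 := hq b
  have h5 : t ≤ 4 * x ∨ t ≤ 4 * b := by omega
  generalize 8 * x / t = X at *
  generalize 8 * a / t = A at *
  generalize 8 * b / t = B at *
  generalize 8 * D / t = E at *
  rcases h5 with h5 | h5
  · have := h3 h5; omega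
  · have := h4 h5; omega

/-- Either `b` has degree at least `t / 4` and saves `2`, or both `x` and `a` do and save `1` each.
One unit pays for the expansion and one remains. -/
theorem expansions_quot_le {t D x a b : ℕ} (ht : 1 ≤ t) (hD : t < D) (h : x + b + a = D)
    (hx : 2 * x ≤ D) (ha : 2 * a ≤ D) :
    (8 * x / t - 1) + (8 * b / t - 2) + (8 * a / t - 1) + 1 ≤ 8 * D / t - 1 := by
  have h1 : 8 * x / t + 8 * b / t + 8 * a / t ≤ 8 * D / t := by
    rw [Nat.le_div_iff_mul_le (by omega), add_mul, add_mul]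
    have := Nat.div_mul_le_self (8 * x) t
    have := Nat.div_mul_le_self (8 * a) t
    have := Nat.div_mul_le_self (8 * b) t
    omega
  have hq : ∀ y, t ≤ 4 * y → 2 ≤ 8 * y / t := fun y hy => by
    rw [Nat.le_div_iff_mul_le (by omega)]; omega
  have h2 := hq a
  have h3 := hq x
  have h4 := hq b
  have h5 : t ≤ 4 * b ∨ (t ≤ 4 * x ∧ t ≤ 4 * a) := by omega
  generalize 8 * x / t = X at *
  generalize 8 * a / t = A at *
  generalize 8 * b / t = B at *
  generalize 8 * D / t = E at *
  rcases h5 with h5 | ⟨h5, h6⟩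
  · have := h4 h5; omega
  · have := h3 h5; have := h2 h6; omega

/-- Values and quotients are treated in one strong induction on the degree, since expanding either
kind produces both. The offsets `2` and `1` strengthen the claim enough for the induction to close.
-/
theorem isSumProd_val_and_quot {t : ℕ} (ht : 1 ≤ t) (D : ℕ) :
    (∀ u, S.deg u = D → IsSumProd t ((Fintype.card U ^ 3) ^ (8 * D / t - 2))
      (1 + 2 * (8 * D / t - 2)) D (S.val u)) ∧
    (∀ u v, S.deg v + D = S.deg u → IsSumProd t ((Fintype.card U ^ 3) ^ (8 * D / t - 1))
      (1 + 2 * (8 * D / t - 1)) D (S.quot u v)) := by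
  induction D using Nat.strong_induction_on with
  | _ D ih =>
    have hM : ∀ u : U, ∀ e, 1 ≤ (Fintype.card U ^ 3) ^ e := fun u e =>
      Nat.one_le_pow _ _ (Nat.one_le_pow _ _ (Fintype.card_pos_iff.2 ⟨u⟩))
    have hv : ∀ u, S.deg u = D → IsSumProd t ((Fintype.card U ^ 3) ^ (8 * D / t - 2))
        (1 + 2 * (8 * D / t - 2)) D (S.val u) := by
      intro u hu
      by_cases hD : D ≤ t
      · exact (IsSumProd.of_isHomogeneous (hu ▸ S.homogeneous u) hD).mono (hM u _) (by omega)
      refine S.isSumProd_of_frontier (m := D / 2) S.val (fun u hu => S.val_eq_sum_weight (by omega))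
        (by omega) ?_
      intro x a b hx ha hab hba hq _
      have hxu : S.deg x ≤ S.deg u := by
        by_contra hlt
        exact hq (S.quot_eq_zero (by omega) (by rintro rfl; omega))
      refine ⟨_, _, _, S.deg u - S.deg x, S.deg b, S.deg a,
        (ih _ (by omega)).2 u x (by omega), (ih _ (by omega)).1 b rfl, (ih _ (by omega)).1 a rfl,
        expansions_val_le ht (by omega) ?_ ?_ hba ?_, ?_⟩ <;> omega
    refine ⟨hv, ?_⟩
    intro u v hu
    by_cases hD : D ≤ t
    · refine (IsSumProd.of_isHomogeneous ?_ hD).mono (hM u _) (by omega)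
      rw [show D = S.deg u - S.deg v by omega]
      exact S.quot_isHomogeneous u v
    refine S.isSumProd_of_frontier (m := S.deg v + D / 2) (fun u => S.quot u v)
      (fun u hu => S.quot_of_ne (by rintro rfl; omega)) (by omega) ?_
    intro x a b hx ha hab hba hq hav
    have hxu : S.deg x ≤ S.deg u := by
      by_contra hlt
      exact hq (S.quot_eq_zero (by omega) (by rintro rfl; omega))
    have hva : S.deg v ≤ S.deg a := by
      by_contra hlt
      exact hav (S.quot_eq_zero (by omega) (by rintro rfl; omega))
    -- The light factor may have the full degree `D`, beyond the induction hypothesis; this is why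
    -- values of degree `D` are settled before quotients.
    have hb : IsSumProd t ((Fintype.card U ^ 3) ^ (8 * S.deg b / t - 2))
        (1 + 2 * (8 * S.deg b / t - 2)) (S.deg b) (S.val b) := by
      by_cases hbD : S.deg b < D
      · exact (ih _ hbD).1 b rfl
      · have hbe : S.deg b = D := by omega
        rw [hbe]
        exact hv b hbe
    refine ⟨_, _, _, S.deg u - S.deg x, S.deg b, S.deg a - S.deg v,
      (ih _ (by omega)).2 u x (by omega), hb, (ih _ (by omega)).2 a v (by omega),
      expansions_quot_le ht (by omega) ?_ ?_ ?_, ?_⟩ <;> omega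

end QuadraticSystem

/-! ### Families closed under quadratic expansion -/

theorem homogeneousComponent_mul {R : Type u} [CommRing R] {σ : Type} (i : ℕ)
    (p q : MvPolynomial σ R) : homogeneousComponent i (p * q) =
      ∑ x ∈ Finset.HasAntidiagonal.antidiagonal i,
        homogeneousComponent x.1 p * homogeneousComponent x.2 q := by
  classical
  ext e
  rw [coeff_homogeneousComponent, coeff_sum]
  simp only [coeff_mul, coeff_homogeneousComponent]
  rw [Finset.sum_comm]
  have key : ∀ y ∈ Finset.HasAntidiagonal.antidiagonal e, ∑ x ∈ Finset.HasAntidiagonal.antidiagonal i,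
      (if y.1.degree = x.1 then coeff y.1 p else 0) *
        (if y.2.degree = x.2 then coeff y.2 q else 0) =
      if e.degree = i then coeff y.1 p * coeff y.2 q else 0 := by
    intro y hy
    have hy' := Finset.HasAntidiagonal.mem_antidiagonal.1 hy
    have hd : e.degree = y.1.degree + y.2.degree := by rw [← hy', map_add]
    rw [hd]
    split_ifs with h
    · rw [Finset.sum_eq_single (y.1.degree, y.2.degree)]
      · simp
      · rintro ⟨a, b⟩ hab hne
        by_cases ha : y.1.degree = a
        · have hb : y.2.degree ≠ b := fun hb => hne (by rw [ha, hb])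
          simp [hb]
        · simp [ha]
      · intro hn
        exact absurd (Finset.HasAntidiagonal.mem_antidiagonal.2 h) hn
    · refine Finset.sum_eq_zero fun x hx => ?_
      have hx' := Finset.HasAntidiagonal.mem_antidiagonal.1 hx
      by_cases ha : y.1.degree = x.1
      · have hb : y.2.degree ≠ x.2 := fun hb => h (by rw [ha, hb, hx'])
        simp [hb]
      · simp [ha]
  rw [Finset.sum_congr rfl key]
  split_ifs <;> simp

section Family

variable {R : Type u} [CommRing R] {σ : Type} {ι : Type} (d : ℕ) (P : ι → MvPolynomial σ R)

/-- The span of the degree-`i` components of a family of polynomials. -/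
noncomputable def linearPart (i : ℕ) : Submodule R (MvPolynomial σ R) :=
  Submodule.span R (Set.range fun q => homogeneousComponent i (P q))

/-- The span of the products of degree `i` of two components of positive degree of a family of
polynomials. -/
noncomputable def quadraticPart (i : ℕ) : Submodule R (MvPolynomial σ R) :=
  Submodule.span R {x | ∃ q r j k, 1 ≤ j ∧ 1 ≤ k ∧ j + k = i ∧
    x = homogeneousComponent j (P q) * homogeneousComponent k (P r)}

/-- The polynomials whose components of positive degree at most `d` are linear in those of the
family. -/
noncomputable def linearSpan : Submodule R (MvPolynomial σ R) :=
  ⨅ i ∈ Set.Icc 1 d, (linearPart P i).comap (homogeneousComponent i)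

/-- The polynomials whose components of degree between `2` and `d` are quadratic in those of the
family. -/
noncomputable def quadraticSpan : Submodule R (MvPolynomial σ R) :=
  ⨅ i ∈ Set.Icc 2 d, (quadraticPart P i).comap (homogeneousComponent i)

variable {d P}

theorem mem_linearSpan {p : MvPolynomial σ R} :
    p ∈ linearSpan d P ↔ ∀ i, 1 ≤ i → i ≤ d → homogeneousComponent i p ∈ linearPart P i := by
  simp [linearSpan]

theorem mem_quadraticSpan {p : MvPolynomial σ R} :
    p ∈ quadraticSpan d P ↔ ∀ i, 2 ≤ i → i ≤ d → homogeneousComponent i p ∈ quadraticPart P i := by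
  simp [quadraticSpan]

theorem family_mem_linearSpan (q : ι) : P q ∈ linearSpan d P :=
  mem_linearSpan.2 fun _ _ _ => Submodule.subset_span ⟨q, rfl⟩

theorem mul_mem_quadraticPart {i j : ℕ} (hi : 1 ≤ i) (hj : 1 ≤ j) {p q : MvPolynomial σ R}
    (hp : p ∈ linearPart P i) (hq : q ∈ linearPart P j) : p * q ∈ quadraticPart P (i + j) := by
  have h := Submodule.mul_mem_mul hp hq
  rw [linearPart, linearPart, Submodule.span_mul_span] at h
  refine Submodule.span_mono ?_ h
  rintro _ ⟨_, ⟨a, rfl⟩, _, ⟨b, rfl⟩, rfl⟩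
  exact ⟨a, b, i, j, hi, hj, rfl, rfl⟩

/-- In each component of the product, the terms with both degrees positive are quadratic by
linearity of the factors. The two extreme terms are scalar multiples of a component of one factor,
so that factor must itself be quadratic. -/
theorem mul_mem_quadraticSpan {p q : MvPolynomial σ R} (hp : p ∈ linearSpan d P)
    (hq : q ∈ linearSpan d P) (hp' : p ∈ quadraticSpan d P) (hq' : q ∈ quadraticSpan d P) :
    p * q ∈ quadraticSpan d P := by
  rw [mem_quadraticSpan] at hp' hq' ⊢
  rw [mem_linearSpan] at hp hq
  intro i hi hid
  rw [homogeneousComponent_mul]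
  refine Submodule.sum_mem _ fun x hx => ?_
  have hx' := Finset.HasAntidiagonal.mem_antidiagonal.1 hx
  obtain ⟨a, b⟩ := x
  simp only at hx' ⊢
  rcases Nat.eq_zero_or_pos a with rfl | ha
  · obtain rfl : b = i := by omega
    rw [homogeneousComponent_zero, ← smul_eq_C_mul]
    exact Submodule.smul_mem _ _ (hq' _ hi hid)
  rcases Nat.eq_zero_or_pos b with rfl | hb
  · obtain rfl : a = i := by omega
    rw [homogeneousComponent_zero, mul_comm, ← smul_eq_C_mul]
    exact Submodule.smul_mem _ _ (hp' _ hi hid)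
  rw [← hx']
  exact mul_mem_quadraticPart ha hb (hp a ha (by omega)) (hq b hb (by omega))

theorem C_mem_quadraticSpan (c : R) : C c ∈ quadraticSpan d P := mem_quadraticSpan.2 fun i hi _ => by
  rw [homogeneousComponent_of_mem (isHomogeneous_C σ c), if_neg (by omega)]
  exact Submodule.zero_mem _

theorem X_mem_quadraticSpan (j : σ) : X j ∈ quadraticSpan d P := mem_quadraticSpan.2 fun i hi _ => by
  rw [homogeneousComponent_of_mem (isHomogeneous_X R j), if_neg (by omega)]
  exact Submodule.zero_mem _

/-- A finite family that is closed under quadratic expansion of its components gives a quadratic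
system. -/
theorem exists_quadraticSystem [Fintype ι] (h : ∀ q, P q ∈ quadraticSpan d P) :
    ∃ S : QuadraticSystem R σ (ι × Fin d), ∀ q i, S.deg (q, i) = i + 1 ∧
      S.val (q, i) = homogeneousComponent (i + 1) (P q) := by
  classical
  let U := ι × Fin d
  let dg : U → ℕ := fun u => u.2 + 1
  let vl : U → MvPolynomial σ R := fun u => homogeneousComponent (u.2 + 1) (P u.1)
  have hex : ∀ u : U, ∃ c : U × U → R, (∀ p, c p ≠ 0 → dg p.1 + dg p.2 = dg u ∧ dg p.2 ≤ dg p.1) ∧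
      (2 ≤ dg u → vl u = ∑ p, c p • (vl p.2 * vl p.1)) := by
    intro u
    by_cases hu : 2 ≤ dg u
    swap
    · exact ⟨0, by simp, fun h => absurd h hu⟩
    have h1 := mem_quadraticSpan.1 (h u.1) (u.2 + 1) hu u.2.2
    let v : U × U → MvPolynomial σ R := fun p =>
      if dg p.1 + dg p.2 = dg u ∧ dg p.2 ≤ dg p.1 then vl p.2 * vl p.1 else 0
    have h2 : vl u ∈ Submodule.span R (Set.range v) := by
      refine Submodule.span_le.2 ?_ h1
      rintro _ ⟨q, r, j, k, hj, hk, hjk, rfl⟩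
      have hud := u.2.2
      let a : U := (q, ⟨j - 1, by omega⟩)
      let b : U := (r, ⟨k - 1, by omega⟩)
      have hda : dg a = j := by simp only [dg, a]; omega
      have hdb : dg b = k := by simp only [dg, b]; omega
      have hva : vl a = homogeneousComponent j (P q) := by
        change homogeneousComponent (dg a) (P q) = _
        rw [hda]
      have hvb : vl b = homogeneousComponent k (P r) := by
        change homogeneousComponent (dg b) (P r) = _
        rw [hdb]
      rw [← hva, ← hvb]
      have hsum : dg a + dg b = dg u := by rw [hda, hdb, hjk]
      refine Submodule.subset_span ?_
      -- Commutativity lets the heavier factor come first.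
      rcases le_total (dg b) (dg a) with hle | hle
      · refine ⟨(a, b), ?_⟩
        simp only [v]
        rw [if_pos ⟨hsum, hle⟩, mul_comm]
      · refine ⟨(b, a), ?_⟩
        simp only [v]
        rw [if_pos ⟨by rw [add_comm]; exact hsum, hle⟩]
    obtain ⟨c, hc⟩ := (Submodule.mem_span_range_iff_exists_fun R).1 h2
    refine ⟨fun p => if dg p.1 + dg p.2 = dg u ∧ dg p.2 ≤ dg p.1 then c p else 0, ?_, ?_⟩
    · intro p hp
      by_contra hn
      exact hp (if_neg hn)
    · intro _
      rw [← hc]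
      refine Finset.sum_congr rfl fun p _ => ?_
      simp only [v]
      split_ifs <;> simp
  choose c hc1 hc2 using hex
  refine ⟨⟨dg, vl, fun u a b => c u (a, b), fun u => Nat.succ_le_succ (Nat.zero_le _),
    fun u => homogeneousComponent_isHomogeneous _ _, fun u a b => hc1 u (a, b), fun u hu => ?_⟩,
    fun q i => ⟨rfl, rfl⟩⟩
  rw [hc2 u hu, Fintype.sum_prod_type]

end Family

/-! ### The quadratic system of a circuit -/

theorem homogeneousComponent_pow_eq_zero {R : Type u} [CommRing R] {σ : Type}
    {y : MvPolynomial σ R} (hy : homogeneousComponent 0 y = 0) (j : ℕ) :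
    ∀ i < j, homogeneousComponent i (y ^ j) = 0 := by
  induction j with
  | zero => intro i hi; omega
  | succ j ih =>
    intro i hi
    rw [pow_succ, homogeneousComponent_mul]
    refine Finset.sum_eq_zero fun x hx => ?_
    have hx' := Finset.HasAntidiagonal.mem_antidiagonal.1 hx
    by_cases h : x.1 < j
    · rw [ih _ h, zero_mul]
    · rw [show x.2 = 0 by omega, hy, mul_zero]

namespace Circuit

variable {R : Type u} [CommRing R] {n : ℕ} (C : Circuit R n)

theorem eval_eq (g : C.V) : C.eval g =
    match C.gate g with
    | .const c => MvPolynomial.C c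
    | .var i => MvPolynomial.X i
    | .add m => (m.map C.eval).sum
    | .mul m => (m.map C.eval).prod := by
  rw [eval, fold_eq]

/-- The polynomial of a gate without its constant term. -/
noncomputable def reducedEval (g : C.V) : MvPolynomial (Fin n) R :=
  C.eval g - MvPolynomial.C (coeff 0 (C.eval g))

open Classical in
/-- The product of the first `l` inputs of `g`, with multiplicities, in a fixed order. -/
noncomputable def prefixProd (g : C.V) (l : ℕ) : MvPolynomial (Fin n) R :=
  ((Finset.univ.toList.take l).map fun h => C.eval h ^ (C.gate g).inputs.count h).prod

/-- The gates, the powers of the gates without constant terms, and the partial products of the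
inputs of a gate. -/
noncomputable def family (d : ℕ) :
    C.V ⊕ (C.V × Fin (d + 1)) ⊕ (C.V × Fin (C.size + 1)) → MvPolynomial (Fin n) R
  | .inl g => C.eval g
  | .inr (.inl x) => C.reducedEval x.1 ^ (x.2 : ℕ)
  | .inr (.inr x) => C.prefixProd x.1 x.2

theorem prefixProd_size (g : C.V) :
    C.prefixProd g C.size = ((C.gate g).inputs.map C.eval).prod := by
  classical
  rw [prefixProd, List.take_of_length_le (by simp [size]), Finset.prod_map_toList,
    Finset.prod_multiset_map_count]
  refine (Finset.prod_subset (Finset.subset_univ _) fun x _ hx => ?_).symm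
  rw [Multiset.mem_toFinset] at hx
  rw [Multiset.count_eq_zero_of_notMem hx, pow_zero]

variable (d : ℕ)

theorem reducedEval_mem_quadraticSpan {g : C.V}
    (hg : C.eval g ∈ quadraticSpan d (C.family d)) :
    C.reducedEval g ∈ quadraticSpan d (C.family d) :=
  Submodule.sub_mem _ hg (C_mem_quadraticSpan _)

/-- Powers up to `d` belong to the family. Higher ones have no component of degree at most `d`,
since the constant term was removed. -/
theorem reducedEval_pow_mem_linearSpan (g : C.V) (j : ℕ) :
    C.reducedEval g ^ j ∈ linearSpan d (C.family d) := by
  by_cases hj : j < d + 1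
  · exact family_mem_linearSpan (P := C.family d) (.inr (.inl (g, ⟨j, hj⟩)))
  · refine mem_linearSpan.2 fun i _ hi => ?_
    rw [homogeneousComponent_pow_eq_zero _ _ _ (by omega)]
    · exact Submodule.zero_mem _
    · simp [reducedEval]

theorem reducedEval_pow_mem_quadraticSpan {g : C.V}
    (hg : C.eval g ∈ quadraticSpan d (C.family d)) (j : ℕ) :
    C.reducedEval g ^ j ∈ quadraticSpan d (C.family d) := by
  induction j with
  | zero => rw [pow_zero, ← map_one MvPolynomial.C]; exact C_mem_quadraticSpan _
  | succ j ih =>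
    rw [pow_succ]
    refine mul_mem_quadraticSpan (C.reducedEval_pow_mem_linearSpan d g j) ?_ ih
      (C.reducedEval_mem_quadraticSpan d hg)
    simpa using C.reducedEval_pow_mem_linearSpan d g 1

/-- Binomial expansion around the constant term: the multiplicity `k` of an arrow is unbounded, yet
only powers of the reduced polynomial occur, with scalar coefficients. -/
theorem eval_pow_mem (g : C.V) (k : ℕ) (W : Submodule R (MvPolynomial (Fin n) R))
    (h : ∀ j, C.reducedEval g ^ j ∈ W) : C.eval g ^ k ∈ W := by
  rw [show C.eval g = C.reducedEval g + MvPolynomial.C (coeff 0 (C.eval g)) by simp [reducedEval],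
    add_pow]
  refine Submodule.sum_mem _ fun j _ => ?_
  rw [← map_pow, mul_assoc, mul_comm, ← map_natCast MvPolynomial.C, ← map_mul, ← smul_eq_C_mul]
  exact Submodule.smul_mem _ _ (h j)

/-- Each partial product is the preceding one, a member of the family, times a power of a single
gate. A product of arbitrary fan-in is thus built from binary ones. -/
theorem prefixProd_mem_quadraticSpan {g : C.V}
    (hg : ∀ h ∈ (C.gate g).inputs, C.eval h ∈ quadraticSpan d (C.family d)) {l : ℕ}
    (hl : l ≤ C.size) : C.prefixProd g l ∈ quadraticSpan d (C.family d) := by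
  classical
  induction l with
  | zero =>
    rw [prefixProd, List.take_zero, List.map_nil, List.prod_nil, ← map_one MvPolynomial.C]
    exact C_mem_quadraticSpan _
  | succ l ih =>
    have hlen : l < (Finset.univ : Finset C.V).toList.length := by simpa [size] using hl
    set h := (Finset.univ : Finset C.V).toList[l] with hh
    have hs : C.prefixProd g (l + 1) = C.prefixProd g l * C.eval h ^ (C.gate g).inputs.count h := by
      rw [prefixProd, List.take_succ_eq_append_getElem hlen, List.map_append, List.prod_append]
      simp [prefixProd, hh]
    rw [hs]
    have hlin : C.prefixProd g l ∈ linearSpan d (C.family d) :=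
      family_mem_linearSpan (P := C.family d) (.inr (.inr (g, ⟨l, by omega⟩)))
    refine mul_mem_quadraticSpan hlin
      (C.eval_pow_mem h _ _ (C.reducedEval_pow_mem_linearSpan d h)) (ih (by omega)) ?_
    by_cases hm : h ∈ (C.gate g).inputs
    · exact C.eval_pow_mem h _ _ (C.reducedEval_pow_mem_quadraticSpan d (hg h hm))
    · rw [Multiset.count_eq_zero_of_notMem hm, pow_zero, ← map_one MvPolynomial.C]
      exact C_mem_quadraticSpan _

theorem eval_mem_quadraticSpan (g : C.V) : C.eval g ∈ quadraticSpan d (C.family d) := by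
  induction g using C.acyclic.induction with
  | _ g ih =>
    rw [eval_eq]
    cases hg : C.gate g with
    | const c => exact C_mem_quadraticSpan c
    | var i => exact X_mem_quadraticSpan i
    | add m =>
      refine multiset_sum_mem _ fun p hp => ?_
      obtain ⟨h, hm, rfl⟩ := Multiset.mem_map.1 hp
      exact ih h (by rw [hg]; exact hm)
    | mul m =>
      have h1 := C.prefixProd_mem_quadraticSpan d ih le_rfl
      rw [prefixProd_size, hg] at h1
      exact h1

theorem family_mem_quadraticSpan (q) : C.family d q ∈ quadraticSpan d (C.family d) := by
  rcases q with g | ⟨g, j⟩ | ⟨g, l⟩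
  · exact C.eval_mem_quadraticSpan d g
  · exact C.reducedEval_pow_mem_quadraticSpan d (C.eval_mem_quadraticSpan d g) j
  · exact C.prefixProd_mem_quadraticSpan d (fun h _ => C.eval_mem_quadraticSpan d h)
      (Nat.le_of_lt_succ l.2)

/-- The number of polynomials in the quadratic system of a circuit. -/
def systemSize (d s : ℕ) : ℕ := (s + (s * (d + 1) + s * (s + 1))) * d

theorem isSumProd_homogeneousComponent {t k : ℕ} (ht : 1 ≤ t) (hkd : k ≤ d) (g : C.V) :
    IsSumProd t ((systemSize d C.size ^ 3) ^ (8 * k / t)) (1 + 2 * (8 * k / t)) k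
      (homogeneousComponent k (C.eval g)) ∧
    (k ≤ t → IsSumProd t 1 1 k (homogeneousComponent k (C.eval g))) := by
  have h0 : k ≤ t → IsSumProd t 1 1 k (homogeneousComponent k (C.eval g)) := fun hk =>
    IsSumProd.of_isHomogeneous (homogeneousComponent_isHomogeneous _ _) hk
  refine ⟨?_, h0⟩
  rcases Nat.eq_zero_or_pos k with rfl | hk
  -- Constants are not in the system, which has positive degrees only; degree `0` is a single
  -- factor.
  · simpa using h0 (Nat.zero_le _)
  obtain ⟨S, hS⟩ := exists_quadraticSystem (C.family_mem_quadraticSpan d)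
  obtain ⟨h1, h2⟩ := hS (.inl g) ⟨k - 1, by omega⟩
  have hk1 : k - 1 + 1 = k := by omega
  have h3 := (S.isSumProd_val_and_quot ht k).1 (.inl g, ⟨k - 1, by omega⟩) (h1.trans hk1)
  rw [h2] at h3
  simp only [hk1, family] at h3
  have hc : Fintype.card ((C.V ⊕ (C.V × Fin (d + 1)) ⊕ (C.V × Fin (C.size + 1))) × Fin d) =
      systemSize d C.size := by
    simp only [Fintype.card_prod, Fintype.card_sum, Fintype.card_fin]
    rfl
  rw [hc] at h3
  have hpos : 1 ≤ systemSize d C.size := by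
    rw [← hc]
    exact Fintype.card_pos_iff.2 ⟨(.inl g, ⟨k - 1, by omega⟩)⟩
  have hle := Nat.sub_le (8 * k / t) 2
  exact h3.mono (Nat.pow_le_pow_right (Nat.one_le_pow _ _ hpos) hle) (by gcongr)

end Circuit

/-! ### Assembling depth-4 circuits -/

/-- The data of a depth-4 circuit: its vertices on each level and the origins of their arrows. -/
structure DepthFour (R : Type u) (n : ℕ) (Leaf Term Factor Summand : Type) where
  leaf : Leaf → R ⊕ Fin n
  term : Term → Multiset Leaf
  factor : Factor → Multiset Term
  summand : Summand → Multiset Factor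
  out : Multiset Summand
  term_ne_zero : ∀ x, term x ≠ 0
  factor_ne_zero : ∀ x, factor x ≠ 0
  summand_ne_zero : ∀ x, summand x ≠ 0
  out_ne_zero : out ≠ 0

namespace DepthFour

variable {R : Type u} {n : ℕ} {Leaf Term Factor Summand : Type}
  (E : DepthFour R n Leaf Term Factor Summand)

/-- The vertices of the circuit. -/
abbrev Vertex (_ : DepthFour R n Leaf Term Factor Summand) : Type :=
  Leaf ⊕ Term ⊕ Factor ⊕ Summand ⊕ Unit

/-- The labels of the vertices. -/
def label : E.Vertex → Gate R n E.Vertex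
  | .inl x => Sum.elim Gate.const Gate.var (E.leaf x)
  | .inr (.inl x) => .mul ((E.term x).map .inl)
  | .inr (.inr (.inl x)) => .add ((E.factor x).map fun y => .inr (.inl y))
  | .inr (.inr (.inr (.inl x))) => .mul ((E.summand x).map fun y => .inr (.inr (.inl y)))
  | .inr (.inr (.inr (.inr _))) => .add (E.out.map fun y => .inr (.inr (.inr (.inl y))))

/-- The levels of the vertices. -/
def level : E.Vertex → ℕ
  | .inl _ => 0
  | .inr (.inl _) => 1
  | .inr (.inr (.inl _)) => 2
  | .inr (.inr (.inr (.inl _))) => 3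
  | .inr (.inr (.inr (.inr _))) => 4

theorem level_of_mem {h g : E.Vertex} (hg : h ∈ (E.label g).inputs) :
    E.level h + 1 = E.level g := by
  rcases g with x | x | x | x | x
  · simp only [label] at hg
    rcases hx : E.leaf x with c | i <;> simp [hx, Gate.inputs] at hg
  all_goals
    simp only [label, Gate.inputs, Multiset.mem_map] at hg
    obtain ⟨y, -, rfl⟩ := hg
    rfl

variable [Fintype Leaf] [Fintype Term] [Fintype Factor] [Fintype Summand]

/-- The circuit with the given data. -/
abbrev toCircuit : Circuit R n where
  V := E.Vertex
  gate := E.label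
  inputs_ne_zero := by
    rintro (x | x | x | x | x) hg
    · simp only [label] at hg
      rcases hx : E.leaf x with c | i <;> simp [hx, Gate.IsComputation] at hg
    · simpa [label, Gate.inputs] using E.term_ne_zero x
    · simpa [label, Gate.inputs] using E.factor_ne_zero x
    · simpa [label, Gate.inputs] using E.summand_ne_zero x
    · simpa [label, Gate.inputs] using E.out_ne_zero
  acyclic := Subrelation.wf (r := InvImage (· < ·) E.level)
    (fun {h g} hg => by
      have := E.level_of_mem hg
      change E.level h < E.level g
      omega) (InvImage.wf _ Nat.lt_wfRel.wf)
  output := .inr (.inr (.inr (.inr ())))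

theorem size_toCircuit : E.toCircuit.size = Fintype.card Leaf + (Fintype.card Term +
    (Fintype.card Factor + (Fintype.card Summand + 1))) := by
  simp only [Circuit.size]
  simp only [Fintype.card_sum, Fintype.card_unit]

theorem isSigmaPiSigmaPi_toCircuit {a b : ℝ} (ha : ∀ x, ((E.summand x).card : ℝ) ≤ a)
    (hb : ∀ x, ((E.term x).card : ℝ) ≤ b) : E.toCircuit.IsSigmaPiSigmaPi a b := by
  refine ⟨E.level, rfl, fun g => ?_⟩
  have hin : ∀ h ∈ (E.label g).inputs, E.level h + 1 = E.level g := fun h => E.level_of_mem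
  unfold Circuit.LayeredAt
  rcases g with x | x | x | x | x
  · simp only [label]
    rcases E.leaf x with c | i <;> rfl
  · exact ⟨Or.inl ⟨rfl, by simpa using hb x⟩, hin⟩
  · exact ⟨Or.inl rfl, hin⟩
  · exact ⟨Or.inr ⟨rfl, by simpa using ha x⟩, hin⟩
  · exact ⟨Or.inr rfl, hin⟩

variable [CommRing R]

/-- The polynomial of a leaf. -/
noncomputable def leafEval (x : Leaf) : MvPolynomial (Fin n) R :=
  Sum.elim MvPolynomial.C MvPolynomial.X (E.leaf x)

/-- The polynomial of a term. -/
noncomputable def termEval (x : Term) : MvPolynomial (Fin n) R :=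
  ((E.term x).map E.leafEval).prod

/-- The polynomial of a factor. -/
noncomputable def factorEval (x : Factor) : MvPolynomial (Fin n) R :=
  ((E.factor x).map E.termEval).sum

theorem eval_toCircuit : E.toCircuit.eval E.toCircuit.output =
    (E.out.map fun y => ((E.summand y).map E.factorEval).prod).sum := by
  have h0 : ∀ x, E.toCircuit.eval (.inl x) = E.leafEval x := fun x => by
    rw [Circuit.eval_eq]
    simp only [toCircuit, label, leafEval]
    rcases E.leaf x with c | i <;> rfl
  have h1 : ∀ x, E.toCircuit.eval (.inr (.inl x)) = E.termEval x := fun x => by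
    rw [Circuit.eval_eq]
    change ((Multiset.map _ (E.term x)).map _).prod = _
    rw [Multiset.map_map, termEval]
    exact congrArg _ (Multiset.map_congr rfl fun y _ => h0 y)
  have h2 : ∀ x, E.toCircuit.eval (.inr (.inr (.inl x))) = E.factorEval x := fun x => by
    rw [Circuit.eval_eq]
    change ((Multiset.map _ (E.factor x)).map _).sum = _
    rw [Multiset.map_map, factorEval]
    exact congrArg _ (Multiset.map_congr rfl fun y _ => h1 y)
  have h3 : ∀ x, E.toCircuit.eval (.inr (.inr (.inr (.inl x)))) =
      ((E.summand x).map E.factorEval).prod := fun x => by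
    rw [Circuit.eval_eq]
    change ((Multiset.map _ (E.summand x)).map _).prod = _
    rw [Multiset.map_map]
    exact congrArg _ (Multiset.map_congr rfl fun y _ => h2 y)
  rw [Circuit.eval_eq]
  change ((Multiset.map _ E.out).map _).sum = _
  rw [Multiset.map_map]
  exact congrArg _ (Multiset.map_congr rfl fun y _ => h3 y)

open Classical in
/-- The degree of a leaf. -/
noncomputable def leafDegree (x : Leaf) : WithBot ℕ :=
  Sum.elim (fun c => if c = 0 then ⊥ else 0) (fun _ => 1) (E.leaf x)

theorem isHomogeneous_toCircuit (δ : Factor → ℕ) (k : ℕ)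
    (h1 : ∀ x, ∀ y ∈ E.factor x, ((E.term y).map E.leafDegree).sum = (δ x : WithBot ℕ))
    (h2 : ∀ y ∈ E.out, ((E.summand y).map δ).sum = k) : E.toCircuit.IsHomogeneous := by
  classical
  have e0 : ∀ x, E.toCircuit.degree (.inl x) = E.leafDegree x := fun x => by
    rw [Circuit.degree, Circuit.fold_eq]
    simp only [toCircuit, label, leafDegree]
    rcases E.leaf x with c | i <;> rfl
  have e1 : ∀ x, E.toCircuit.degree (.inr (.inl x)) = ((E.term x).map E.leafDegree).sum :=
    fun x => by
      rw [Circuit.degree, Circuit.fold_eq]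
      change ((Multiset.map _ (E.term x)).map _).sum = _
      rw [Multiset.map_map]
      exact congrArg _ (Multiset.map_congr rfl fun y _ => e0 y)
  have e2 : ∀ x, E.toCircuit.degree (.inr (.inr (.inl x))) = (δ x : WithBot ℕ) := fun x => by
    rw [Circuit.degree, Circuit.fold_eq]
    change ((Multiset.map _ (E.factor x)).map _).sup = _
    rw [Multiset.map_map]
    have : (E.factor x).map (E.toCircuit.degree ∘ fun y => .inr (.inl y)) =
        Multiset.replicate (E.factor x).card (δ x : WithBot ℕ) := by
      rw [← Multiset.map_const']
      exact Multiset.map_congr rfl fun y hy => (e1 y).trans (h1 x y hy)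
    refine (congrArg Multiset.sup this).trans ?_
    -- Nonemptiness matters here: the supremum over no inputs would be `⊥`.
    refine le_antisymm (Multiset.sup_le.2 fun b hb => (Multiset.eq_of_mem_replicate hb).le) ?_
    refine Multiset.le_sup (Multiset.mem_replicate.2 ⟨?_, rfl⟩)
    simpa using E.factor_ne_zero x
  have e3 : ∀ y ∈ E.out, E.toCircuit.degree (.inr (.inr (.inr (.inl y)))) = (k : WithBot ℕ) :=
    fun y hy => by
      rw [Circuit.degree, Circuit.fold_eq]
      change ((Multiset.map _ (E.summand y)).map _).sum = _
      rw [Multiset.map_map, ← h2 y hy]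
      refine (congrArg _ (Multiset.map_congr rfl fun y _ => e2 y)).trans ?_
      induction E.summand y using Multiset.induction_on with
      | empty => simp
      | cons a s ih => rw [Multiset.map_cons, Multiset.sum_cons, ih, Multiset.map_cons,
          Multiset.sum_cons, Nat.cast_add]
  intro g m hg
  rcases g with x | x | x | x | x
  · simp only [toCircuit, label] at hg
    rcases hx : E.leaf x with c | i <;> simp [hx] at hg
  · simp [toCircuit, label] at hg
  · simp only [toCircuit, label, Gate.add.injEq] at hg
    subst hg
    have key : ∀ h ∈ (E.factor x).map (fun y => (Sum.inr (Sum.inl y) : E.Vertex)),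
        E.toCircuit.degree h = (δ x : WithBot ℕ) := by
      intro h hh
      obtain ⟨y, hy, rfl⟩ := Multiset.mem_map.1 hh
      exact (e1 y).trans (h1 x y hy)
    exact fun h hh h' hh' => (key h hh).trans (key h' hh').symm
  · simp [toCircuit, label] at hg
  · simp only [toCircuit, label, Gate.add.injEq] at hg
    subst hg
    have key : ∀ h ∈ E.out.map (fun y => (Sum.inr (Sum.inr (Sum.inr (Sum.inl y))) : E.Vertex)),
        E.toCircuit.degree h = (k : WithBot ℕ) := by
      intro h hh
      obtain ⟨y, hy, rfl⟩ := Multiset.mem_map.1 hh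
      exact e3 y hy
    exact fun h hh h' hh' => (key h hh).trans (key h' hh').symm

/-- The circuit data of a single constant. -/
def ofConst (c : R) : DepthFour R n Unit Unit Unit Unit where
  leaf _ := .inl c
  term _ := {()}
  factor _ := {()}
  summand _ := {()}
  out := {()}
  term_ne_zero _ := by simp
  factor_ne_zero _ := by simp
  summand_ne_zero _ := by simp
  out_ne_zero := by simp

end DepthFour

/-- Every monomial of degree `e` is the commutative image of a word of length `e` in the variables.
-/
theorem card_support_le_pow {R : Type u} [CommRing R] {n e t : ℕ} {q : MvPolynomial (Fin n) R}
    (hq : q.IsHomogeneous e) (hn : 1 ≤ n) (het : e ≤ t) : q.support.card ≤ n ^ t := by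
  classical
  have hsub : q.support ⊆ Finset.univ.image fun v : Fin e → Fin n =>
      Multiset.toFinsupp (Multiset.ofList (List.ofFn v)) := by
    intro m hm
    have hd : m.degree = e := by
      by_contra hne
      exact mem_support_iff.1 hm (hq.coeff_eq_zero hne)
    obtain ⟨l, hl⟩ := Quot.exists_rep (Finsupp.toMultiset m)
    have hlen : l.length = e := by
      have h1 := congrArg Multiset.card hl
      rw [Finsupp.card_toMultiset] at h1
      rw [← hd, Finsupp.degree_eq_sum]
      rw [Finsupp.sum_fintype _ _ (by simp)] at h1
      exact h1
    subst hlen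
    refine Finset.mem_image.2 ⟨l.get, Finset.mem_univ _, ?_⟩
    rw [List.ofFn_get, show Multiset.ofList l = Finsupp.toMultiset m from hl]
    simp
  calc q.support.card ≤ _ := Finset.card_le_card hsub
    _ ≤ _ := Finset.card_image_le
    _ = n ^ e := by simp
    _ ≤ n ^ t := Nat.pow_le_pow_right hn het

theorem card_toMultiset_eq_degree {n : ℕ} (m : Fin n →₀ ℕ) : (Finsupp.toMultiset m).card = m.degree := by
  rw [Finsupp.card_toMultiset, Finsupp.degree_eq_sum, Finsupp.sum_fintype _ _ (by simp)]
  rfl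

theorem prod_X_toMultiset {R : Type u} [CommRing R] {n : ℕ} (m : Fin n →₀ ℕ) :
    ((Finsupp.toMultiset m).map (X : Fin n → MvPolynomial (Fin n) R)).prod = monomial m 1 := by
  rw [Finsupp.toMultiset_map, Finsupp.prod_toMultiset, monomial_eq, C_1, one_mul,
    Finsupp.prod_mapDomain_index (by simp) (by intros; rw [pow_add])]

namespace DepthFour

variable {R : Type u} [CommRing R] {n : ℕ}

/-- The circuit data of a sum of products of nonzero polynomials that are expanded into
monomials. -/
noncomputable def ofProducts {S : Type} [Fintype S] [Nonempty S] (A : S → Type)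
    [∀ s, Fintype (A s)] [∀ s, Nonempty (A s)] (F : (Σ s, A s) → MvPolynomial (Fin n) R)
    (hF : ∀ x, F x ≠ 0) :
    DepthFour R n ((Σ x, (F x).support) ⊕ Fin n) (Σ x, (F x).support) (Σ s, A s) S where
  leaf := Sum.map (fun x => coeff x.2 (F x.1)) id
  -- The coefficient is one more input, so the fan-in is the degree plus one. It is nonzero, hence
  -- of degree `0`, and does not disturb homogeneity.
  term x := .inl x ::ₘ (Finsupp.toMultiset x.2.1).map .inr
  factor x := Finset.univ.val.map fun m => ⟨x, m⟩
  summand s := Finset.univ.val.map fun a => ⟨s, a⟩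
  out := Finset.univ.val
  term_ne_zero _ := Multiset.cons_ne_zero
  factor_ne_zero x := by
    have : (Finset.univ : Finset (F x).support).Nonempty := by
      obtain ⟨m, hm⟩ := Finset.nonempty_of_ne_empty (mt support_eq_empty.1 (hF x))
      exact ⟨⟨m, hm⟩, Finset.mem_univ _⟩
    rw [Ne, Multiset.map_eq_zero, Finset.val_eq_zero]
    exact this.ne_empty
  summand_ne_zero s := by
    rw [Ne, Multiset.map_eq_zero, Finset.val_eq_zero]
    exact Finset.univ_nonempty.ne_empty
  out_ne_zero := by
    rw [Ne, Finset.val_eq_zero]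
    exact Finset.univ_nonempty.ne_empty

section

variable {S : Type} [Fintype S] [Nonempty S] (A : S → Type)
    [∀ s, Fintype (A s)] [∀ s, Nonempty (A s)] (F : (Σ s, A s) → MvPolynomial (Fin n) R)
    (hF : ∀ x, F x ≠ 0)

theorem factorEval_ofProducts (x : Σ s, A s) : (ofProducts A F hF).factorEval x = F x := by
  have h1 : ∀ m : (F x).support, (ofProducts A F hF).termEval ⟨x, m⟩ =
      monomial m.1 (coeff m.1 (F x)) := fun m => by
    change (Multiset.map _ (_ ::ₘ _)).prod = _
    rw [Multiset.map_cons, Multiset.prod_cons, Multiset.map_map]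
    change C (coeff m.1 (F x)) * ((Finsupp.toMultiset m.1).map X).prod = _
    rw [prod_X_toMultiset, C_mul_monomial, mul_one]
  change (Multiset.map _ (Multiset.map _ _)).sum = _
  rw [Multiset.map_map]
  refine (congrArg _ (Multiset.map_congr rfl fun m _ => h1 m)).trans ?_
  change ∑ m : (F x).support, monomial m.1 (coeff m.1 (F x)) = F x
  rw [Finset.sum_coe_sort (F x).support fun m => monomial m (coeff m (F x)),
    support_sum_monomial_coeff]

theorem eval_ofProducts : (ofProducts A F hF).toCircuit.eval (ofProducts A F hF).toCircuit.output =
    ∑ s, ∏ a, F ⟨s, a⟩ := by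
  rw [eval_toCircuit]
  change ∑ s, (Multiset.map _ (Multiset.map _ _)).prod = _
  refine Finset.sum_congr rfl fun s _ => ?_
  rw [Multiset.map_map]
  exact congrArg _ (Multiset.map_congr rfl fun a _ => factorEval_ofProducts A F hF _)

theorem isHomogeneous_ofProducts (δ : (Σ s, A s) → ℕ) (k : ℕ)
    (hδ : ∀ x, (F x).IsHomogeneous (δ x)) (hk : ∀ s, ∑ a, δ ⟨s, a⟩ = k) :
    (ofProducts A F hF).toCircuit.IsHomogeneous := by
  refine isHomogeneous_toCircuit _ δ k ?_ ?_
  · intro x y hy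
    obtain ⟨m, -, rfl⟩ := Multiset.mem_map.1 hy
    change (Multiset.map _ (_ ::ₘ _)).sum = _
    rw [Multiset.map_cons, Multiset.sum_cons, Multiset.map_map]
    have h0 : (ofProducts A F hF).leafDegree (.inl ⟨x, m⟩) = 0 := if_neg (mem_support_iff.1 m.2)
    have h1 : ((Finsupp.toMultiset m.1).map
        ((ofProducts A F hF).leafDegree ∘ Sum.inr)).sum = (m.1.degree : WithBot ℕ) := by
      refine (congrArg Multiset.sum (Multiset.map_congr rfl fun i _ => show _ = (1 : WithBot ℕ)
        from rfl)).trans ?_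
      rw [Multiset.map_const', Multiset.sum_replicate, card_toMultiset_eq_degree, nsmul_one]
    have hd : m.1.degree = δ x := by
      by_contra hne
      exact mem_support_iff.1 m.2 ((hδ x).coeff_eq_zero hne)
    exact (congrArg₂ (· + ·) h0 h1).trans (by rw [zero_add, hd])
  · intro s _
    change (Multiset.map _ (Multiset.map _ _)).sum = _
    rw [Multiset.map_map]
    exact hk s

theorem size_ofProducts_le {N k t : ℕ} (hn : 1 ≤ n) (ht : 1 ≤ t) (hk : 1 ≤ k)
    (hN : Fintype.card S ≤ N) (hA : ∀ s, Fintype.card (A s) ≤ k)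
    (hδ : ∀ x, ∃ e ≤ t, (F x).IsHomogeneous e) :
    (ofProducts A F hF).toCircuit.size ≤ 6 * (N * k * n ^ t) := by
  rw [size_toCircuit]
  have hS : 1 ≤ Fintype.card S := Fintype.card_pos
  have hfac : Fintype.card (Σ s, A s) ≤ N * k := by
    rw [Fintype.card_sigma]
    refine (Finset.sum_le_card_nsmul _ _ k fun s _ => hA s).trans ?_
    rw [smul_eq_mul, Finset.card_univ]
    exact Nat.mul_le_mul_right _ hN
  have hterm : Fintype.card (Σ x, (F x).support) ≤ N * k * n ^ t := by
    rw [Fintype.card_sigma]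
    refine (Finset.sum_le_card_nsmul _ _ (n ^ t) fun x _ => ?_).trans ?_
    · obtain ⟨e, he, hx⟩ := hδ x
      rw [Fintype.card_coe]
      exact card_support_le_pow hx hn he
    · rw [smul_eq_mul, Finset.card_univ]
      exact Nat.mul_le_mul_right _ hfac
  have hnt : n ≤ n ^ t := Nat.le_self_pow (by omega) n
  have hNk : 1 ≤ N * k := Nat.mul_pos (by omega) (by omega)
  have hpow : 1 ≤ n ^ t := Nat.one_le_pow _ _ hn
  have h1 : n ^ t ≤ N * k * n ^ t := Nat.le_mul_of_pos_left _ hNk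
  have h2 : N * k ≤ N * k * n ^ t := Nat.le_mul_of_pos_right _ hpow
  have h3 : N ≤ N * k := Nat.le_mul_of_pos_right _ hk
  change Fintype.card ((Σ x, (F x).support) ⊕ Fin n) + (Fintype.card (Σ x, (F x).support) +
    (Fintype.card (Σ s, A s) + (Fintype.card S + 1))) ≤ _
  rw [Fintype.card_sum, Fintype.card_fin]
  omega

theorem isSigmaPiSigmaPi_ofProducts {k t : ℕ} {a b : ℝ} (hA : ∀ s, Fintype.card (A s) ≤ k)
    (hδ : ∀ x, ∃ e ≤ t, (F x).IsHomogeneous e) (ha : (k : ℝ) ≤ a) (hb : (t : ℝ) + 1 ≤ b) :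
    (ofProducts A F hF).toCircuit.IsSigmaPiSigmaPi a b := by
  refine isSigmaPiSigmaPi_toCircuit _ (fun s => le_trans ?_ ha) (fun x => le_trans ?_ hb)
  · change ((Multiset.map _ _).card : ℝ) ≤ _
    rw [Multiset.card_map]
    exact_mod_cast hA s
  · change ((_ ::ₘ _).card : ℝ) ≤ _
    rw [Multiset.card_cons, Multiset.card_map, card_toMultiset_eq_degree]
    obtain ⟨e, he, hx⟩ := hδ x.1
    have hd : x.2.1.degree = e := by
      by_contra hne
      exact mem_support_iff.1 x.2.2 (hx.coeff_eq_zero hne)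
    rw [hd]
    exact_mod_cast Nat.succ_le_succ he

end

/-- The circuit data of a polynomial that is expanded into monomials on the upper levels. -/
noncomputable def ofMonomials (f : MvPolynomial (Fin n) R) (hf : f ≠ 0) :
    DepthFour R n (f.support ⊕ Fin n) (f.support ⊕ Fin n) (f.support ⊕ Fin n) f.support where
  leaf := Sum.map (fun m => coeff m f) id
  -- Levels 1 and 2 merely pass each leaf on through gates of fan-in one.
  term x := {x}
  factor x := {x}
  summand m := .inl m ::ₘ (Finsupp.toMultiset m.1).map .inr
  out := Finset.univ.val
  term_ne_zero _ := by simp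
  factor_ne_zero _ := by simp
  summand_ne_zero _ := Multiset.cons_ne_zero
  out_ne_zero := by
    obtain ⟨m, hm⟩ := Finset.nonempty_of_ne_empty (mt support_eq_empty.1 hf)
    rw [Ne, Finset.val_eq_zero]
    exact Finset.ne_empty_of_mem (Finset.mem_univ (⟨m, hm⟩ : f.support))

theorem eval_ofMonomials (f : MvPolynomial (Fin n) R) (hf : f ≠ 0) :
    (ofMonomials f hf).toCircuit.eval (ofMonomials f hf).toCircuit.output = f := by
  rw [eval_toCircuit]
  have h1 : ∀ x, (ofMonomials f hf).factorEval x = (ofMonomials f hf).leafEval x := fun x => by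
    simp [factorEval, termEval, ofMonomials]
  have h2 : ∀ m : f.support, (((ofMonomials f hf).summand m).map
      (ofMonomials f hf).factorEval).prod = monomial m.1 (coeff m.1 f) := fun m => by
    rw [funext h1]
    change (Multiset.map _ (_ ::ₘ _)).prod = _
    rw [Multiset.map_cons, Multiset.prod_cons, Multiset.map_map]
    change C (coeff m.1 f) * ((Finsupp.toMultiset m.1).map X).prod = _
    rw [prod_X_toMultiset, C_mul_monomial, mul_one]
  refine (congrArg _ (Multiset.map_congr rfl fun m _ => h2 m)).trans ?_
  change ∑ m : f.support, monomial m.1 (coeff m.1 f) = f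
  rw [Finset.sum_coe_sort f.support fun m => monomial m (coeff m f), support_sum_monomial_coeff]

theorem isHomogeneous_ofMonomials (f : MvPolynomial (Fin n) R) (hf : f ≠ 0) {k : ℕ}
    (hk : f.IsHomogeneous k) : (ofMonomials f hf).toCircuit.IsHomogeneous := by
  refine isHomogeneous_toCircuit _ (Sum.elim (fun _ => 0) fun _ => 1) k ?_ ?_
  · intro x y hy
    obtain rfl : y = x := by simpa [ofMonomials] using hy
    rcases y with m | i
    · have h0 : (ofMonomials f hf).leafDegree (.inl m) = 0 := if_neg (mem_support_iff.1 m.2)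
      simpa [ofMonomials] using h0
    · have h0 : (ofMonomials f hf).leafDegree (.inr i) = 1 := rfl
      simpa [ofMonomials] using h0
  · intro m _
    have hd : m.1.degree = k := by
      by_contra hne
      exact mem_support_iff.1 m.2 (hk.coeff_eq_zero hne)
    change (Multiset.map _ (_ ::ₘ _)).sum = _
    rw [Multiset.map_cons, Multiset.sum_cons, Multiset.map_map]
    change 0 + ((Finsupp.toMultiset m.1).map fun _ => 1).sum = k
    rw [Multiset.map_const', Multiset.sum_replicate, card_toMultiset_eq_degree, hd]
    simp

theorem size_ofMonomials (f : MvPolynomial (Fin n) R) (hf : f ≠ 0) :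
    (ofMonomials f hf).toCircuit.size = 4 * f.support.card + 3 * n + 1 := by
  rw [size_toCircuit]
  rw [Fintype.card_sum, Fintype.card_fin, Fintype.card_coe]
  ring

theorem isSigmaPiSigmaPi_ofMonomials (f : MvPolynomial (Fin n) R) (hf : f ≠ 0) {a b : ℝ}
    (ha : (f.totalDegree : ℝ) + 1 ≤ a) (hb : 1 ≤ b) :
    (ofMonomials f hf).toCircuit.IsSigmaPiSigmaPi a b := by
  refine isSigmaPiSigmaPi_toCircuit _ (fun m => le_trans ?_ ha) (fun x => ?_)
  · change ((_ ::ₘ _).card : ℝ) ≤ _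
    rw [Multiset.card_cons, Multiset.card_map, card_toMultiset_eq_degree]
    have h : m.1.degree ≤ f.totalDegree := le_totalDegree m.2
    exact_mod_cast Nat.succ_le_succ h
  · simpa [ofMonomials] using hb

end DepthFour

/-! ### From sums of products to circuits -/

theorem exists_circuit_of_list {R : Type u} [CommRing R] {n N k t : ℕ} {a b : ℝ}
    {f : MvPolynomial (Fin n) R} (hf : f ≠ 0) (L : List (List (ℕ × MvPolynomial (Fin n) R)))
    (hN : L.length ≤ N)
    (hL : ∀ l ∈ L, l ≠ [] ∧ l.length ≤ k ∧ ∀ q ∈ l, q.2.IsHomogeneous q.1 ∧ q.1 ≤ t)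
    (hsum : (L.map fun l => (l.map Prod.snd).prod).sum = f) (hn : 1 ≤ n) (ht : 1 ≤ t)
    (ha : (k : ℝ) ≤ a) (hb : (t : ℝ) + 1 ≤ b) :
    ∃ D : Circuit R n, D.Computes f ∧ D.IsSigmaPiSigmaPi a b ∧ D.size ≤ 6 * (N * k * n ^ t) ∧
      ((∃ e, ∀ l ∈ L, (l.map Prod.fst).sum = e) → D.IsHomogeneous) := by
  classical
  -- Products with a zero factor are discarded: a zero polynomial has no monomials and would leave a
  -- `+`-gate without inputs. Something remains because `f ≠ 0`.
  let p : List (ℕ × MvPolynomial (Fin n) R) → Bool := fun l => decide (∀ q ∈ l, q.2 ≠ 0)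
  let L' := L.filter p
  have hsum' : (L'.map fun l => (l.map Prod.snd).prod).sum = f := by
    rw [← hsum]
    clear hsum hN hL
    simp only [L']
    induction L with
    | nil => rfl
    | cons l L ih =>
      rw [List.filter_cons]
      split_ifs with h
      · simp [ih]
      · have h0 : (l.map Prod.snd).prod = 0 := by
          simp only [p, decide_eq_true_eq, not_forall, not_not] at h
          obtain ⟨q, hq, hq0⟩ := h
          exact List.prod_eq_zero (List.mem_map.2 ⟨q, hq, hq0⟩)
        rw [List.map_cons, List.sum_cons, h0, zero_add, ih]
  have hL' : ∀ l ∈ L', l ∈ L ∧ ∀ q ∈ l, q.2 ≠ 0 := fun l hl => by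
    simpa [L', p] using hl
  have hne : L' ≠ [] := by
    intro h0
    rw [h0] at hsum'
    exact hf hsum'.symm
  let S := Fin L'.length
  have hmem : ∀ s : S, L'.get s ∈ L' := fun s => List.get_mem _ _
  have : Nonempty S := ⟨⟨0, List.length_pos_iff.2 hne⟩⟩
  have : ∀ s, Nonempty (Fin (L'.get s).length) := fun s =>
    ⟨⟨0, List.length_pos_iff.2 (hL _ (hL' _ (hmem s)).1).1⟩⟩
  let G : (Σ s, Fin (L'.get s).length) → ℕ × MvPolynomial (Fin n) R := fun x => (L'.get x.1).get x.2
  have hG : ∀ x, G x ∈ L'.get x.1 := fun x => List.get_mem _ _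
  have hF : ∀ x, (G x).2 ≠ 0 := fun x => (hL' _ (hmem x.1)).2 _ (hG x)
  have hδ : ∀ x, (G x).2.IsHomogeneous (G x).1 ∧ (G x).1 ≤ t := fun x =>
    (hL _ (hL' _ (hmem x.1)).1).2.2 _ (hG x)
  have hk : 1 ≤ k := by
    obtain ⟨s⟩ := ‹Nonempty S›
    obtain ⟨h1, h2, -⟩ := hL _ (hL' _ (hmem s)).1
    have := List.length_pos_iff.2 h1
    omega
  have hA : ∀ s, Fintype.card (Fin (L'.get s).length) ≤ k := fun s => by
    rw [Fintype.card_fin]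
    exact (hL _ (hL' _ (hmem s)).1).2.1
  refine ⟨(DepthFour.ofProducts (fun s => Fin (L'.get s).length) (fun x => (G x).2) hF).toCircuit, ?_,
    DepthFour.isSigmaPiSigmaPi_ofProducts (fun s => Fin (L'.get s).length) _ hF hA
      (fun x => ⟨_, (hδ x).2, (hδ x).1⟩) ha hb,
    DepthFour.size_ofProducts_le _ _ hF hn ht hk ?_ hA (fun x => ⟨_, (hδ x).2, (hδ x).1⟩), ?_⟩
  · rw [Circuit.Computes, DepthFour.eval_ofProducts, ← hsum']
    rw [← Fin.sum_univ_fun_getElem]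
    refine Finset.sum_congr rfl fun s _ => ?_
    exact Fin.prod_univ_fun_getElem _ _
  · rw [Fintype.card_fin]
    exact (List.length_filter_le _ _).trans hN
  · rintro ⟨e, he⟩
    refine DepthFour.isHomogeneous_ofProducts (fun s => Fin (L'.get s).length) _ hF (fun x => (G x).1) e
      (fun x => (hδ x).1) ?_
    intro s
    rw [← he _ (hL' _ (hmem s)).1]
    exact Fin.sum_univ_fun_getElem _ _

theorem DepthFour.isHomogeneous_ofConst {R : Type u} [CommRing R] {n : ℕ} (c : R) :
    (DepthFour.ofConst c : DepthFour R n _ _ _ _).toCircuit.IsHomogeneous := by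
  intro g m hg
  rcases g with x | x | x | x | x <;> simp [DepthFour.label, DepthFour.ofConst] at hg
  all_goals
    subst hg
    simp

theorem DepthFour.exists_circuit_zero {R : Type u} [CommRing R] {n : ℕ} {a b : ℝ} (ha : 1 ≤ a)
    (hb : 1 ≤ b) : ∃ D : Circuit R n, D.Computes 0 ∧ D.IsSigmaPiSigmaPi a b ∧ D.size = 5 ∧
      D.IsHomogeneous := by
  refine ⟨(DepthFour.ofConst 0).toCircuit, ?_, ?_, ?_, DepthFour.isHomogeneous_ofConst 0⟩
  · rw [Circuit.Computes, DepthFour.eval_toCircuit]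
    simp [DepthFour.ofConst, DepthFour.factorEval, DepthFour.termEval, DepthFour.leafEval]
  · exact DepthFour.isSigmaPiSigmaPi_toCircuit _ (by simpa [DepthFour.ofConst] using ha)
      (by simpa [DepthFour.ofConst] using hb)
  · rw [DepthFour.size_toCircuit]
    simp

theorem sum_homogeneousComponent_of_le {R : Type u} [CommRing R] {σ : Type}
    {f : MvPolynomial σ R} {d : ℕ} (h : f.totalDegree ≤ d) :
    ∑ i ∈ Finset.range (d + 1), homogeneousComponent i f = f := by
  conv_rhs => rw [← sum_homogeneousComponent f]
  symm
  refine Finset.sum_subset (Finset.range_subset_range.2 (by omega)) fun i _ hi => ?_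
  exact homogeneousComponent_eq_zero _ _ (by simpa using hi)

theorem card_support_le {R : Type u} [CommRing R] {n d : ℕ} {f : MvPolynomial (Fin n) R}
    (h : f.totalDegree ≤ d) (hn : 1 ≤ n) : f.support.card ≤ (d + 1) * n ^ d := by
  classical
  have hsub : f.support ⊆ (Finset.range (d + 1)).biUnion fun i =>
      (homogeneousComponent i f).support := by
    conv_lhs => rw [← sum_homogeneousComponent_of_le h]
    exact support_sum
  refine (Finset.card_le_card hsub).trans ((Finset.card_biUnion_le_card_mul _ _ (n ^ d) ?_).trans
    (by simp))
  intro i hi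
  exact card_support_le_pow (homogeneousComponent_isHomogeneous i f) hn
    (Nat.lt_succ_iff.1 (Finset.mem_range.1 hi))

theorem exists_list_of_isSumProd {R : Type u} [CommRing R] {σ : Type} {t N k d : ℕ}
    {f : MvPolynomial σ R} (hf0 : f ≠ 0) (hf : f.totalDegree ≤ d)
    (h : ∀ i ≤ d, IsSumProd t N k i (homogeneousComponent i f)) :
    ∃ L : List (List (ℕ × MvPolynomial σ R)), L.length ≤ (d + 1) * N ∧
      (∀ l ∈ L, l ≠ [] ∧ l.length ≤ k ∧ ∀ q ∈ l, q.2.IsHomogeneous q.1 ∧ q.1 ≤ t) ∧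
      (L.map fun l => (l.map Prod.snd).prod).sum = f ∧
      ((∃ e, f.IsHomogeneous e) → ∃ e, ∀ l ∈ L, (l.map Prod.fst).sum = e) := by
  -- For homogeneous `f` only the component of its own degree is used. Representations of the other
  -- components, though they sum to zero, could contain products of other degrees.
  by_cases hom : ∃ e, f.IsHomogeneous e
  · obtain ⟨e, he⟩ := hom
    have hed : e ≤ d := (he.totalDegree hf0) ▸ hf
    obtain ⟨L, h1, h2, h3⟩ := h e hed
    refine ⟨L, h1.trans (Nat.le_mul_of_pos_left _ (by omega)),
      fun l hl => ⟨(h2 l hl).1, (h2 l hl).2.1, (h2 l hl).2.2.2⟩, ?_,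
      fun _ => ⟨e, fun l hl => (h2 l hl).2.2.1⟩⟩
    rw [h3, homogeneousComponent_eq_self he]
  · have key : ∀ m ≤ d + 1, ∃ L : List (List (ℕ × MvPolynomial σ R)), L.length ≤ m * N ∧
        (∀ l ∈ L, l ≠ [] ∧ l.length ≤ k ∧ ∀ q ∈ l, q.2.IsHomogeneous q.1 ∧ q.1 ≤ t) ∧
        (L.map fun l => (l.map Prod.snd).prod).sum =
          ∑ i ∈ Finset.range m, homogeneousComponent i f := by
      intro m
      induction m with
      | zero => exact fun _ => ⟨[], by simp, by simp, by simp⟩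
      | succ m ih =>
        intro hm
        obtain ⟨L, h1, h2, h3⟩ := ih (by omega)
        obtain ⟨L', h1', h2', h3'⟩ := h m (by omega)
        refine ⟨L ++ L', ?_, fun l hl => ?_, ?_⟩
        · rw [List.length_append, add_mul, one_mul]
          exact Nat.add_le_add h1 h1'
        · rcases List.mem_append.1 hl with hl | hl
          · exact h2 l hl
          · exact ⟨(h2' l hl).1, (h2' l hl).2.1, (h2' l hl).2.2.2⟩
        · rw [List.map_append, List.sum_append, h3, h3', Finset.sum_range_succ]
    obtain ⟨L, h1, h2, h3⟩ := key (d + 1) le_rfl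
    exact ⟨L, h1, h2, h3.trans (sum_homogeneousComponent_of_le hf), fun h => absurd h hom⟩

theorem exists_circuit_of_isSumProd {R : Type u} [CommRing R] {n t N k d : ℕ} {a b : ℝ}
    {f : MvPolynomial (Fin n) R} (hf0 : f ≠ 0) (hf : f.totalDegree ≤ d)
    (h : ∀ i ≤ d, IsSumProd t N k i (homogeneousComponent i f)) (hn : 1 ≤ n) (ht : 1 ≤ t)
    (ha : (k : ℝ) ≤ a) (hb : (t : ℝ) + 1 ≤ b) :
    ∃ D : Circuit R n, D.Computes f ∧ D.IsSigmaPiSigmaPi a b ∧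
      D.size ≤ 6 * ((d + 1) * N * k * n ^ t) ∧
      ((∃ e, f.IsHomogeneous e) → D.IsHomogeneous) := by
  obtain ⟨L, h1, h2, h3, h4⟩ := exists_list_of_isSumProd hf0 hf h
  obtain ⟨D, h5, h6, h7, h8⟩ := exists_circuit_of_list hf0 L h1 h2 h3 hn ht ha hb
  exact ⟨D, h5, h6, h7, fun h => h8 (h4 h)⟩

/-! ### Numerical estimates -/

/-- The relations between the fan-ins and the exponent of the size that the estimates need. -/
theorem fanIn_relations {d n s : ℕ} (hn : 2 ≤ n) (hns : n ≤ s) (hd : 1 ≤ d) :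
    ∃ α β σ ℓ lam : ℝ, α = Real.sqrt (d * (Real.log n / Real.log (d * s))) ∧
      β = Real.sqrt (d * (Real.log (d * s) / Real.log n)) ∧
      σ = Real.sqrt (d * Real.log (d * s) * Real.log n) ∧ ℓ = Real.log n ∧
      lam = Real.log (d * s) ∧ 1 / 2 ≤ ℓ ∧ ℓ ≤ lam ∧ α * lam = σ ∧ β * ℓ = σ ∧ α * β = d ∧
      1 ≤ β ∧ 0 < α ∧ α ≤ β := by
  have hn' : (2 : ℝ) ≤ n := by exact_mod_cast hn
  have hd' : (1 : ℝ) ≤ d := by exact_mod_cast hd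
  have hs' : (n : ℝ) ≤ s := by exact_mod_cast hns
  have hnds : (n : ℝ) ≤ d * s := by nlinarith
  have hℓ : 1 / 2 ≤ Real.log n := by
    have := Real.log_two_gt_d9
    have := Real.log_le_log (by norm_num) hn'
    linarith
  have hle : Real.log n ≤ Real.log (d * s) := Real.log_le_log (by linarith) hnds
  set ℓ := Real.log n
  set lam := Real.log (d * s)
  have hℓ0 : 0 < ℓ := by linarith
  have hlam0 : 0 < lam := by linarith
  have hratio : ℓ / lam ≤ 1 := (div_le_one hlam0).2 hle
  have hratio' : 1 ≤ lam / ℓ := (one_le_div hℓ0).2 hle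
  refine ⟨_, _, _, _, _, rfl, rfl, rfl, rfl, rfl, hℓ, hle, ?_, ?_, ?_, ?_, ?_, ?_⟩
  · nth_rewrite 2 [← Real.sqrt_sq hlam0.le]
    rw [← Real.sqrt_mul (by positivity)]
    congr 1
    field_simp
  · nth_rewrite 2 [← Real.sqrt_sq hℓ0.le]
    rw [← Real.sqrt_mul (by positivity)]
    congr 1
    field_simp
  · rw [← Real.sqrt_mul (by positivity),
      show (d : ℝ) * (ℓ / lam) * (d * (lam / ℓ)) = (d : ℝ) ^ 2 by field_simp,
      Real.sqrt_sq (by positivity)]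
  · rw [Real.one_le_sqrt]
    exact one_le_mul_of_one_le_of_one_le hd' hratio'
  · exact Real.sqrt_pos.2 (by positivity)
  · exact Real.sqrt_le_sqrt (mul_le_mul_of_nonneg_left (hratio.trans hratio') (by positivity))

theorem systemSize_le {d s : ℕ} (hd : 1 ≤ d) (hs : 2 ≤ s) :
    Circuit.systemSize d s ≤ (d * s) ^ 5 := by
  have h2 : 2 ≤ d * s := hs.trans (Nat.le_mul_of_pos_left _ hd)
  have h1 : Circuit.systemSize d s ≤ 5 * (d * s) ^ 2 := by
    obtain ⟨d, rfl⟩ := Nat.exists_eq_add_of_le' hd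
    obtain ⟨s, rfl⟩ := Nat.exists_eq_add_of_le' hs
    rw [Circuit.systemSize]
    ring_nf
    nlinarith [Nat.zero_le (d * s), Nat.zero_le (d * s ^ 2), Nat.zero_le (d ^ 2 * s),
      Nat.zero_le (d ^ 2 * s ^ 2)]
  calc _ ≤ 5 * (d * s) ^ 2 := h1
    _ ≤ (d * s) ^ 3 * (d * s) ^ 2 :=
      Nat.mul_le_mul_right _ (le_trans (by norm_num) (Nat.pow_le_pow_left h2 3))
    _ = (d * s) ^ 5 := by ring

theorem exp_le_two_rpow {c σ : ℝ} (hc : c ≤ 500) (hσ : 0 ≤ σ) :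
    Real.exp (c * σ) ≤ (2 : ℝ) ^ (1000 * σ) := by
  rw [Real.rpow_def_of_pos (by norm_num)]
  refine Real.exp_le_exp.2 ?_
  -- Only `log 2 > 1 / 2` is needed, whence the factor `2` between `500` and `1000`.
  have := Real.log_two_gt_d9
  nlinarith

/-- The size estimate that all the cases share. -/
theorem size_le_two_rpow {d n t N k : ℕ} {α β σ ℓ : ℝ} (hℓ : ℓ = Real.log n) (hn : 1 ≤ n)
    (hℓ' : 1 / 2 ≤ ℓ) (hβσ : β * ℓ = σ) (hd : α * β = d) (hβ : 1 ≤ β) (hαβ : α ≤ β)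
    (hN : (N : ℝ) ≤ Real.exp (360 * σ)) (hk : (k : ℝ) ≤ Real.exp (100 * σ)) (ht : (t : ℝ) ≤ 2 * β) :
    ((8 * ((d + 1) * N * k * n ^ t) : ℕ) : ℝ) ≤ (2 : ℝ) ^ (1000 * σ) := by
  have hσ : 1 / 2 ≤ σ := by nlinarith
  have hβ2 : β ≤ 2 * σ := by nlinarith
  have h8 : (8 : ℝ) ≤ Real.exp (14 * σ) := by
    have := Real.add_one_le_exp (14 * σ)
    linarith
  have hd1 : (d : ℝ) + 1 ≤ Real.exp (4 * σ) := by
    have h1 := Real.quadratic_le_exp_of_nonneg (x := 4 * σ) (by linarith)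
    have h2 : (d : ℝ) ≤ 2 * σ * (2 * σ) := by
      rw [← hd]
      exact mul_le_mul (by linarith) hβ2 (by linarith) (by linarith)
    nlinarith
  have hnt : (n : ℝ) ^ t ≤ Real.exp (2 * σ) := by
    have hn0 : (0 : ℝ) < n := by exact_mod_cast hn
    rw [← Real.exp_log hn0, ← Real.exp_nat_mul, ← hℓ]
    refine Real.exp_le_exp.2 ?_
    nlinarith
  calc ((8 * ((d + 1) * N * k * n ^ t) : ℕ) : ℝ)
      = 8 * (((d : ℝ) + 1) * N * k * (n : ℝ) ^ t) := by push_cast; ring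
    -- The exponents `14 + 4 + 360 + 100 + 2` add up to `480`, below the permitted `500`.
    _ ≤ Real.exp (14 * σ) * (Real.exp (4 * σ) * Real.exp (360 * σ) * Real.exp (100 * σ) *
        Real.exp (2 * σ)) := by gcongr
    _ = Real.exp (480 * σ) := by
      rw [← Real.exp_add, ← Real.exp_add, ← Real.exp_add, ← Real.exp_add]
      congr 1
      ring
    _ ≤ _ := exp_le_two_rpow (by norm_num) (by linarith)

/-! ### The depth-4 reduction -/

theorem theorem1 :
    ∃ K : ℝ, 0 < K ∧
      ∀ (R : Type u) [CommRing R] (n d s : ℕ) (f : MvPolynomial (Fin n) R) (C : Circuit R n),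
        2 ≤ n → n ≤ s → 1 ≤ d →
        f.totalDegree ≤ d → C.size = s → C.Computes f →
        ∃ D : Circuit R n,
          D.Computes f ∧
          D.IsSigmaPiSigmaPi
            (max 1 (K * Real.sqrt (d * (Real.log n / Real.log (d * s)))))
            (Real.sqrt (d * (Real.log (d * s) / Real.log n))) ∧
          (D.size : ℝ) ≤ (2 : ℝ) ^ (K * Real.sqrt (d * Real.log (d * s) * Real.log n)) ∧
          ((∃ k : ℕ, f.IsHomogeneous k) → D.IsHomogeneous) := by
  refine ⟨1000, by norm_num, ?_⟩
  intro R _ n d s f C hn hns hd hf hsize hC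
  obtain ⟨α, β, σ, ℓ, lam, hα, hβ, hσ, hℓ, hlam, hℓ', hℓlam, hαlam, hβℓ, hαβ, hβ1, hα0, hαleβ⟩ :=
    fanIn_relations hn hns hd
  rw [← hα, ← hβ, ← hσ]
  have hσ0 : 1 / 2 ≤ σ := by nlinarith
  have hexp1 : ∀ c : ℝ, 0 ≤ c → 1 ≤ Real.exp (c * σ) := fun c hc =>
    Real.one_le_exp (by nlinarith)
  have hd1 : (1 : ℝ) ≤ d := by exact_mod_cast hd
  by_cases hf0 : f = 0
  · subst hf0
    obtain ⟨D, h1, h2, h3, h4⟩ := DepthFour.exists_circuit_zero (R := R) (n := n)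
      (le_max_left 1 (1000 * α)) hβ1
    refine ⟨D, h1, h2, ?_, fun _ => h4⟩
    rw [h3]
    have h5 := Real.add_one_le_exp (14 * σ)
    have h6 := exp_le_two_rpow (c := 14) (σ := σ) (by norm_num) (by linarith)
    push_cast
    linarith
  -- No room is left at level 1 for both a coefficient and a variable. But then `d = α * β < 4` and
  -- `α ≥ 1 / 2`, so `f` can be expanded into monomials at level 3, with fan-in at most `4 ≤ 1000 *
  -- α`.
  by_cases hβ2 : β < 2
  · have hd4 : d ≤ 3 := by
      have : (d : ℝ) < 4 := by rw [← hαβ]; nlinarith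
      have : d < 4 := by exact_mod_cast this
      omega
    have hα2 : 1 / 2 ≤ α := by nlinarith
    refine ⟨(DepthFour.ofMonomials f hf0).toCircuit, DepthFour.eval_ofMonomials f hf0,
      DepthFour.isSigmaPiSigmaPi_ofMonomials f hf0 ?_ hβ1, ?_,
      fun ⟨k, hk⟩ => DepthFour.isHomogeneous_ofMonomials f hf0 hk⟩
    · refine le_trans ?_ (le_max_right _ _)
      have : (f.totalDegree : ℝ) ≤ 3 := by exact_mod_cast hf.trans hd4
      linarith
    · rw [DepthFour.size_ofMonomials]
      refine le_trans (Nat.cast_le.2 ?_) (size_le_two_rpow (t := d) (d := d) (N := 1) (k := 1) hℓ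
        (by omega) hℓ' hβℓ hαβ hβ1 hαleβ (by simpa using hexp1 360 (by norm_num))
        (by simpa using hexp1 100 (by norm_num)) (by rw [← hαβ]; nlinarith))
      have h1 := card_support_le hf (by omega : 1 ≤ n)
      have h2 : n ≤ n ^ d := Nat.le_self_pow (by omega) n
      have h3 : n ^ d ≤ (d + 1) * n ^ d := Nat.le_mul_of_pos_left _ (by omega)
      simp only [mul_one]
      omega
  push Not at hβ2
  have hfl : 2 ≤ ⌊β⌋₊ := Nat.le_floor (by exact_mod_cast hβ2)
  -- One unit of the fan-in `β` is reserved for the coefficient, so the factors may have degree at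
  -- most `⌊β⌋ - 1`.
  obtain ⟨t, ht⟩ : ∃ t, ⌊β⌋₊ = t + 1 := ⟨⌊β⌋₊ - 1, by omega⟩
  have ht1 : 1 ≤ t := by omega
  have htβ : (t : ℝ) + 1 ≤ β := by
    have := Nat.floor_le (by linarith : 0 ≤ β)
    rw [ht] at this
    exact_mod_cast this
  have hβt : β < t + 2 := by
    have := Nat.lt_floor_add_one β
    rw [ht] at this
    push_cast at this
    linarith
  have ht1' : (1 : ℝ) ≤ t := by exact_mod_cast ht1
  have hcomp : C.eval C.output = f := hC
  suffices h : ∃ N k : ℕ, (∀ i ≤ d, IsSumProd t N k i (homogeneousComponent i f)) ∧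
      (k : ℝ) ≤ max 1 (1000 * α) ∧ (N : ℝ) ≤ Real.exp (360 * σ) ∧
      (k : ℝ) ≤ Real.exp (100 * σ) by
    obtain ⟨N, k, h1, h2, h3, h4⟩ := h
    obtain ⟨D, h5, h6, h7, h8⟩ := exists_circuit_of_isSumProd hf0 hf h1 (by omega) ht1 h2 htβ
    refine ⟨D, h5, h6, le_trans (Nat.cast_le.2 (h7.trans ?_)) (size_le_two_rpow (d := d)
      (t := t) (N := N) (k := k) hℓ (by omega) hℓ' hβℓ hαβ hβ1 hαleβ h3 h4 (by linarith)), h8⟩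
    exact Nat.mul_le_mul_right _ (by norm_num)
  -- Here `d = α * β < β / 2`, which forces `d ≤ t`: each component is already a single admissible
  -- factor, and fan-in `1` suffices at level 3.
  by_cases hα2 : α < 1 / 2
  · have hdt : d ≤ t := by
      have h1 : (d : ℝ) + 1 < t + 2 := by nlinarith
      have h2 : d + 1 < t + 2 := by exact_mod_cast h1
      omega
    refine ⟨1, 1, fun i hi => ?_, by simp, by simpa using hexp1 360 (by norm_num),
      by simpa using hexp1 100 (by norm_num)⟩
    exact IsSumProd.of_isHomogeneous (homogeneousComponent_isHomogeneous _ _) (hi.trans hdt)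
  push Not at hα2
  have hpos : 1 ≤ Circuit.systemSize d s := by
    rw [Circuit.systemSize]
    exact Nat.mul_pos (by omega) hd
  -- Since `β < t + 2 ≤ 3 * t`, the ratio `d / t = α * β / t` is at most `3 * α`.
  have he : ((8 * d / t : ℕ) : ℝ) ≤ 24 * α := by
    refine Nat.cast_div_le.trans ?_
    rw [div_le_iff₀ (by linarith)]
    push_cast
    rw [← hαβ]
    nlinarith
  have hk : ((1 + 2 * (8 * d / t) : ℕ) : ℝ) ≤ 50 * α := by
    push_cast at he ⊢
    linarith
  have hα2σ : α ≤ 2 * σ := by nlinarith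
  refine ⟨(Circuit.systemSize d s ^ 3) ^ (8 * d / t), 1 + 2 * (8 * d / t), fun i hi => ?_,
    le_trans (hk.trans (by linarith)) (le_max_right _ _), ?_, ?_⟩
  · have h1 := (C.isSumProd_homogeneousComponent d ht1 hi C.output).1
    rw [hcomp, hsize] at h1
    have h2 : 8 * i / t ≤ 8 * d / t := Nat.div_le_div_right (by omega)
    exact h1.mono (Nat.pow_le_pow_right (Nat.one_le_pow _ _ hpos) h2) (by gcongr)
  · have hds : (0 : ℝ) < d * s := by
      have : (2 : ℝ) ≤ s := by exact_mod_cast hn.trans hns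
      positivity
    -- The exponent `15` is the cube from each expansion times the fifth power bounding the system;
    -- with at most `24 * α` expansions this gives `360 * α * lam = 360 * σ`.
    have h1 : (Circuit.systemSize d s ^ 3) ^ (8 * d / t) ≤ (d * s) ^ (15 * (8 * d / t)) := by
      rw [show (d * s) ^ (15 * (8 * d / t)) = (((d * s) ^ 5) ^ 3) ^ (8 * d / t) by
        rw [← pow_mul, ← pow_mul]
        congr 1
        ring]
      exact Nat.pow_le_pow_left (Nat.pow_le_pow_left (systemSize_le hd (hn.trans hns)) _) _
    calc (((Circuit.systemSize d s ^ 3) ^ (8 * d / t) : ℕ) : ℝ)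
        ≤ (((d * s) ^ (15 * (8 * d / t)) : ℕ) : ℝ) := Nat.cast_le.2 h1
      _ = Real.exp (((15 * (8 * d / t) : ℕ) : ℝ) * lam) := by
        rw [Real.exp_nat_mul, hlam, Real.exp_log hds]
        push_cast
        rfl
      _ ≤ Real.exp (360 * σ) := by
        refine Real.exp_le_exp.2 ?_
        rw [← hαlam]
        push_cast at he ⊢
        nlinarith
  · have := Real.add_one_le_exp (100 * σ)
    linarith
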